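/- **Theorem 1.2 (refined $L^\infty_{x_2}L^4_{t,x_1}$-type Strichartz estimate).** Write $\mathbb T=\mathbb R/2\pi\mathbb Z$, let $d\xi$ be the product of Lebesgue measure on $\mathbb R$ and counting measure on $\mathbb Z$, and let $|\cdot|$ be the Euclidean norm on $\mathbb R^2\supset\mathbb R\times\mathbb Z$. For $\phi\in L^2(\mathbb R\times\mathbb T)$ let $$\widehat\phi(\xi_1,\xi_2)=\frac1{4\pi^2}\int_0^{2\pi}\int_{\mathbb R}\phi(x_1,x_2)e^{-i(\xi_1x_1+\xi_2x_2)}\,dx_1\,dx_2,\qquad(\xi_1,\xi_2)\in\mathbb R\times\mathbb Z,$$ understood in the $L^2$ (Plancherel) sense. Fix a Schwartz function $\varphi:\mathbb R\to\mathbb R$ such that $\varphi\ge0$ on $\mathbb R$, $\varphi\ge1$ on $[0,1]$, and its Fourier transform $\widehat\varphi(\tau)=\frac1{2\pi}\int_{\mathbb R}\varphi(t)e^{-i\tau t}\,dt$ is real and nonnegative everywhere and is supported in $[-1,1]$. Let $0<\delta<\frac18$. Then there is a constant $C>0$, depending only on $\varphi$ and $\delta$, such that the following holds for all real $1\le M\le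 N$, all $a\in\mathbb R^2$ with $|a|=1$, all $c\in\mathbb R$ and all $\xi_0\in\mathbb R\times\mathbb Z$. Put $$\mathcal R=\{\xi\in\mathbb R\times\mathbb Z:\ |\xi-\xi_0|\le N,\ |a\cdot\xi-c|\le M\}.$$ If $\phi\in L^2(\mathbb R\times\mathbb T)$ and $\operatorname{supp}\widehat\phi\subset\mathcal R$ (that is, $\widehat\phi=0$ almost everywhere outside $\mathcal R$), then $\widehat\phi\in L^1(\mathbb R\times\mathbb Z)$ and $$\left\|\varphi(t)\int_{\mathbb R\times\mathbb Z}e^{ix_1\xi_1-it|\xi|^2}\,\widehat\phi(\xi)\,d\xi\right\|_{L^4_{t,x_1}(\mathbb R\times\mathbb R)}\le C\left(\frac MN\right)^{\delta}N^{\frac14}\,\|\phi\|_{L^2(\mathbb R\times\mathbb T)}.$$ -/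

import Mathlib

open MeasureTheory FourierTransform SchwartzMap
open scoped Real ENNReal

/-- The circle `ℝ / 2πℤ` needs a positive period to carry its measure, of total mass `2π`. -/
instance instFactZeroLtTwoPi : Fact ((0 : ℝ) < 2 * π) := ⟨Real.two_pi_pos⟩

namespace Waveguide

noncomputable section

/-- The torus `𝕋 = ℝ / 2πℤ`. -/
abbrev Torus : Type := AddCircle (2 * π)

/-- The space `L²(ℝ × 𝕋)`, for the product of the Lebesgue measures. -/
abbrev L2RT : Type := Lp ℂ 2 (volume : Measure (ℝ × Torus))

/-- The measure `dξ` on `ℝ × ℤ`: the product of Lebesgue and counting measure. -/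
def freqMeasure : Measure (ℝ × ℤ) := (volume : Measure ℝ).prod Measure.count

/-- A frequency `ξ ∈ ℝ × ℤ` viewed as a vector of the Euclidean plane. -/
def toPlane (ξ : ℝ × ℤ) : EuclideanSpace ℝ (Fin 2) := !₂[ξ.1, (ξ.2 : ℝ)]

/-- The slab `{ξ ∈ ℝ × ℤ : |ξ - ξ₀| ≤ N, |a · ξ - c| ≤ M}`. -/
def slab (a : EuclideanSpace ℝ (Fin 2)) (c : ℝ) (ξ₀ : ℝ × ℤ) (M N : ℝ) : Set (ℝ × ℤ) :=
  {ξ | ‖toPlane ξ - toPlane ξ₀‖ ≤ N ∧ |inner ℝ a (toPlane ξ) - c| ≤ M}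

/-! ### The Fourier transform on `ℝ × 𝕋`

For `f ∈ L²(ℝ × 𝕋)`, the Fourier coefficient in the second variable,
`c_k(x₁) = (2π)⁻¹ ∫_𝕋 f(x₁, x₂) e^{-i k x₂} dx₂`, is in `L²(ℝ)`; its Fourier-Plancherel transform
in the first variable is the Fourier transform of `f`. -/

/-- The `k`-th Fourier coefficient in the second variable, as a function of the first one. -/
def partialCoeff (f : ℝ × Torus → ℂ) (k : ℤ) (x : ℝ) : ℂ :=
  fourierCoeff (fun y : Torus => f (x, y)) k

theorem memLp_partialCoeff {f : ℝ × Torus → ℂ} (hf : MemLp f 2 volume) (k : ℤ) :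
    MemLp (partialCoeff f k) 2 volume := by
  set μ : Measure (ℝ × Torus) := (volume : Measure ℝ).prod AddCircle.haarAddCircle with hμ
  have hvol : (volume : Measure (ℝ × Torus)) = ENNReal.ofReal (2 * π) • μ := by
    rw [Measure.volume_eq_prod, AddCircle.volume_eq_smul_haarAddCircle, Measure.prod_smul_right]
  have hc0 : ENNReal.ofReal (2 * π) ≠ 0 := by simp [Real.pi_pos]
  have hfμ : MemLp f 2 μ := by
    refine hf.of_measure_le_smul (c := (ENNReal.ofReal (2 * π))⁻¹) (ENNReal.inv_ne_top.2 hc0) ?_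
    rw [hvol, smul_smul, ENNReal.inv_mul_cancel hc0 ENNReal.ofReal_ne_top, one_smul]
  have hmeas : AEStronglyMeasurable (fun p : ℝ × Torus => _root_.fourier (-k) p.2 • f p) μ := by
    have h : AEStronglyMeasurable
        (fun p : ℝ × Torus => (_root_.fourier (-k) : C(Torus, ℂ)) p.2) μ :=
      ((_root_.fourier (-k)).continuous.comp continuous_snd).aestronglyMeasurable
    exact h.smul hfμ.1
  refine ⟨hmeas.integral_prod_right', ?_⟩
  have hsq : ∫⁻ p, ‖f p‖ₑ ^ (2 : ℝ) ∂μ < ∞ := by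
    have := (eLpNorm_lt_top_iff_lintegral_rpow_enorm_lt_top (by simp) (by simp)).1 hfμ.2
    simpa using this
  rw [eLpNorm_lt_top_iff_lintegral_rpow_enorm_lt_top (by simp) (by simp)]
  have hmeasf : AEMeasurable (fun p : ℝ × Torus => ‖f p‖ₑ ^ (2 : ℝ)) μ :=
    hfμ.1.enorm.pow_const _
  rw [lintegral_prod _ hmeasf] at hsq
  refine lt_of_le_of_lt (lintegral_mono_ae ?_) hsq
  filter_upwards [hfμ.1.prodMk_left] with x hx
  have h1 : ‖partialCoeff f k x‖ₑ ≤ eLpNorm (fun y => f (x, y)) 1 AddCircle.haarAddCircle := by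
    unfold partialCoeff fourierCoeff
    refine (enorm_integral_le_lintegral_enorm _).trans ?_
    rw [eLpNorm_one_eq_lintegral_enorm]
    refine lintegral_mono fun y => ?_
    have h : ‖(_root_.fourier (-k) : C(Torus, ℂ)) y‖ₑ = 1 := by
      rw [← ofReal_norm, fourier_apply, Circle.norm_coe, ENNReal.ofReal_one]
    rw [enorm_smul, h, one_mul]
  have h2 := h1.trans (eLpNorm_le_eLpNorm_of_exponent_le (p := 1) (q := 2) (by norm_num) hx)
  rw [eLpNorm_eq_lintegral_rpow_enorm_toReal (by simp) (by simp)] at h2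
  have h3 := ENNReal.rpow_le_rpow h2 (by norm_num : (0 : ℝ) ≤ 2)
  rw [← ENNReal.rpow_mul] at h3
  simpa using h3

/-- The `k`-th Fourier coefficient in the second variable, as an element of `L²(ℝ)`. -/
def partialCoeffLp (f : L2RT) (k : ℤ) : Lp ℂ 2 (volume : Measure ℝ) :=
  MemLp.toLp (partialCoeff f k) (memLp_partialCoeff (Lp.memLp f) k)

/-- The Fourier transform
`f̂(ξ₁, ξ₂) = (4π²)⁻¹ ∫_ℝ ∫_𝕋 f(x₁, x₂) e^{-i(ξ₁ x₁ + ξ₂ x₂)} dx₂ dx₁` of `f ∈ L²(ℝ × 𝕋)`.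
Mathlib's Fourier transform `𝓕` on `L²(ℝ)` has the kernel `e^{-2π i x w}`, hence `w = ξ₁ / 2π`. -/
def fourierRT (f : L2RT) (ξ : ℝ × ℤ) : ℂ :=
  (1 / (2 * π) : ℂ) * (𝓕 (partialCoeffLp f ξ.2)) (ξ.1 / (2 * π))

/-- `supp f̂ ⊆ S` (for a closed set `S`): `f̂` vanishes almost everywhere outside `S`. -/
def FourierSupportIn (f : L2RT) (S : Set (ℝ × ℤ)) : Prop :=
  ∀ᵐ ξ ∂freqMeasure, ξ ∉ S → fourierRT f ξ = 0

/-- `∫_{ℝ × ℤ} e^{i x ξ₁ - i t |ξ|²} f̂(ξ) dξ`. -/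
def evolution (f : L2RT) (t x : ℝ) : ℂ :=
  ∫ ξ, Complex.exp (Complex.I * ((x * ξ.1 - t * ‖toPlane ξ‖ ^ 2 : ℝ) : ℂ)) * fourierRT f ξ
    ∂freqMeasure

/-- The Fourier transform `(2π)⁻¹ ∫ f(t) e^{-i τ t} dt` on `ℝ`. -/
def fourierR (f : ℝ → ℂ) (τ : ℝ) : ℂ :=
  (1 / (2 * π) : ℂ) * ∫ t, f t * Complex.exp (-(Complex.I * ((τ * t : ℝ) : ℂ)))

/-- The Schwartz functions that are used as a smooth substitute for the characteristic function of
the unit interval. -/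
structure IsTimeCutoff (φ : 𝓢(ℝ, ℝ)) : Prop where
  fourier_im : ∀ τ, (fourierR (fun t => (φ t : ℂ)) τ).im = 0
  fourier_nonneg : ∀ τ, 0 ≤ (fourierR (fun t => (φ t : ℂ)) τ).re
  fourier_support : tsupport (fourierR (fun t => (φ t : ℂ))) ⊆ Set.Icc (-1) 1
  nonneg : ∀ t, 0 ≤ φ t
  one_le : ∀ t ∈ Set.Icc (0 : ℝ) 1, 1 ≤ φ t

end

end Waveguide

open Waveguide

/-! The fourth power of the norm is reduced to counting resonances. Since `φ` is nonnegative and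
bounded, one factor `φ` may be kept as a weight in place of `φ ^ 4`. The square of the evolution is
an oscillatory integral over pairs of frequencies, with phase given by the total first momentum `k`
and the total energy `T`. Integrating its squared modulus against `φ(t) e^{-b x²}` leaves a kernel
which is bounded by `∫ φ`, vanishes unless the two energies differ by at most `1` (Fourier support
of `φ`), and carries a Gaussian in the difference of momenta whose mass is `2π` for every `b`.
Schur's test (`lintegral_lintegral_mul_mul_le_of_schur`) then bounds everything by the supremum over
`k` and `T` of the measure of the pairs in the slab with momentum `k` and energy within `1` of `T`,
and Fatou's lemma removes the Gaussian as `b → 0`.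

It remains to bound this measure by a multiple of `N (M/N)^{4δ}`
(`exists_tsum_volume_resonantSlice_le`). After centring at `k/2`, the pairs form a shell `|2x² + m²
+ n² - T'| ≤ 1` with `x` real and `m`, `n` integers in an interval of radius `N`. Let `a = (a₀, a₁)`
and `θ = √(M/N)`.

If `|a₁| ≥ θ/2`, adding the two slab conditions confines `m + n` to an interval of length of order
`Nθ = √(MN)`. For each value of `m + n` the remaining planar annulus has slices at integral heights
of bounded total length, whatever its radius (`tsum_volume_annulus_slice_le`).

If `|a₁| < θ/2`, then `x` is confined to an interval of length of order `Nθ`. Where `|x| ≥ √N`, the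
fibres in `x` are short and lattice points in annuli are counted by area (`count_annulus_le`). Where
`|x| ≤ √N`, one needs that a circle has `O(N^ε)` lattice points in a box of radius `N`, uniformly in
the position of the box (`exists_ncard_circleBox_le`). This follows from the divisor bound for
Gaussian integers, and from an elementary argument when the box is far from the origin. -/

/-! ### Gaussian integers of given norm -/

namespace GaussianInt

/-- The Gaussian integers of norm `n`. -/
def normSet (n : ℕ) : Set GaussianInt := {z | z.norm = n}

theorem mem_normSet {n : ℕ} {z : GaussianInt} : z ∈ normSet n ↔ z.norm = n := Iff.rfl

theorem mem_Icc_of_mem_normSet {n : ℕ} {z : GaussianInt} (hz : z ∈ normSet n) :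
    z.re ∈ Set.Icc (-(n : ℤ)) n ∧ z.im ∈ Set.Icc (-(n : ℤ)) n := by
  rw [mem_normSet, Zsqrtd.norm_def] at hz
  have hn : (n : ℤ) ≤ (n : ℤ) ^ 2 := by exact_mod_cast Nat.le_self_pow two_ne_zero n
  exact ⟨abs_le_of_sq_le_sq' (by nlinarith [mul_self_nonneg z.im]) (by positivity),
    abs_le_of_sq_le_sq' (by nlinarith [mul_self_nonneg z.re]) (by positivity)⟩

theorem normSet_subset (n : ℕ) : normSet n ⊆ (fun p : ℤ × ℤ => (⟨p.1, p.2⟩ : GaussianInt)) ''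
    ((Finset.Icc (-(n : ℤ)) n ×ˢ Finset.Icc (-(n : ℤ)) n : Finset (ℤ × ℤ)) : Set (ℤ × ℤ)) := by
  intro z hz
  obtain ⟨h1, h2⟩ := mem_Icc_of_mem_normSet hz
  exact ⟨(z.re, z.im), Finset.mem_coe.2 (Finset.mem_product.2
    ⟨Finset.mem_Icc.2 h1, Finset.mem_Icc.2 h2⟩), rfl⟩

theorem finite_normSet (n : ℕ) : (normSet n).Finite :=
  ((Finset.finite_toSet _).image _).subset (normSet_subset n)

theorem norm_star (z : GaussianInt) : (star z).norm = z.norm := by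
  simp [Zsqrtd.norm_def]

theorem dvd_or_star_dvd {ϖ z : GaussianInt} (h : Prime ϖ) (hd : ϖ ∣ (z.norm : GaussianInt)) :
    ϖ ∣ z ∨ star ϖ ∣ z := by
  rw [Zsqrtd.norm_eq_mul_conj] at hd
  rcases h.dvd_or_dvd hd with h1 | h1
  · exact Or.inl h1
  · right
    obtain ⟨w, hw⟩ := h1
    exact ⟨star w, by rw [← star_star z, hw, star_mul, mul_comm]⟩

/-- A Gaussian prime over a rational prime has norm `p` or `p ^ 2`. -/
theorem exists_prime_over (p : ℕ) (hp : p.Prime) :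
    ∃ ϖ : GaussianInt, Prime ϖ ∧ ϖ ∣ (p : GaussianInt) ∧ (ϖ.norm = p ∨ ϖ.norm = (p : ℤ) ^ 2) := by
  have hnu : ¬ IsUnit (p : GaussianInt) := by
    rw [← Zsqrtd.norm_eq_one_iff]
    rw [Zsqrtd.norm_natCast, Int.natAbs_mul, Int.natAbs_natCast]
    exact fun h => hp.ne_one (Nat.eq_one_of_mul_eq_one_left h)
  have hne : (p : GaussianInt) ≠ 0 := by exact_mod_cast hp.ne_zero
  obtain ⟨ϖ, hϖ, hd⟩ := WfDvdMonoid.exists_irreducible_factor hnu hne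
  refine ⟨ϖ, hϖ.prime, hd, ?_⟩
  obtain ⟨w, hw⟩ := hd
  have hn : (p : ℤ) * p = ϖ.norm * w.norm := by
    rw [← Zsqrtd.norm_mul, ← hw, Zsqrtd.norm_natCast]
  have hn' : p ^ 2 = ϖ.norm.natAbs * w.norm.natAbs := by
    rw [← Int.natAbs_mul, ← hn, ← Int.natCast_mul, Int.natAbs_natCast, sq]
  have h1 : ϖ.norm.natAbs ∣ p ^ 2 := ⟨_, hn'⟩
  rw [Nat.dvd_prime_pow hp] at h1
  obtain ⟨k, hk, hk'⟩ := h1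
  have hnn : (ϖ.norm.natAbs : ℤ) = ϖ.norm := Int.natAbs_of_nonneg (norm_nonneg _)
  interval_cases k
  · exact absurd (Zsqrtd.norm_eq_one_iff.1 (by simpa using hk')) hϖ.not_isUnit
  · left; rw [← hnn, hk']; simp
  · right; rw [← hnn, hk']; simp

/-- Each factor `p` of the norm lets one divide `z` by `ϖ` or by its conjugate, and either division
removes exactly one `p`. The factorization need not be unique, so `p = 2` and `p ∣ n` are allowed;
only an upper count is wanted. -/
theorem exists_factorization (p : ℕ) {ϖ : GaussianInt} (hp : p.Prime) (hϖ : Prime ϖ)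
    (hd : ϖ ∣ (p : GaussianInt)) (hn : ϖ.norm = p) (n : ℕ) (e : ℕ) :
    ∀ z ∈ normSet (p ^ e * n), ∃ a ≤ e, ∃ w ∈ normSet n, z = ϖ ^ a * star ϖ ^ (e - a) * w := by
  induction e with
  | zero => intro z hz; exact ⟨0, le_rfl, z, by simpa using hz, by simp⟩
  | succ e ih =>
    intro z hz
    rw [mem_normSet] at hz
    have hdz : ϖ ∣ (z.norm : GaussianInt) := by
      rw [hz]
      refine hd.trans ⟨(p : GaussianInt) ^ e * n, ?_⟩
      push_cast; ring
    have hp0 : (p : ℤ) ≠ 0 := by exact_mod_cast hp.ne_zero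
    rcases dvd_or_star_dvd hϖ hdz with ⟨w, hw⟩ | ⟨w, hw⟩
    · have hwn : w ∈ normSet (p ^ e * n) := by
        rw [mem_normSet]
        rw [hw, Zsqrtd.norm_mul, hn] at hz
        apply mul_left_cancel₀ hp0
        rw [hz]; push_cast; ring
      obtain ⟨a, ha, v, hv, rfl⟩ := ih w hwn
      refine ⟨a + 1, by omega, v, hv, ?_⟩
      rw [hw, Nat.add_sub_add_right]; ring
    · have hwn : w ∈ normSet (p ^ e * n) := by
        rw [mem_normSet]
        rw [hw, Zsqrtd.norm_mul, norm_star, hn] at hz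
        apply mul_left_cancel₀ hp0
        rw [hz]; push_cast; ring
      obtain ⟨a, ha, v, hv, rfl⟩ := ih w hwn
      refine ⟨a, by omega, v, hv, ?_⟩
      rw [hw, Nat.sub_add_comm ha]; ring

theorem associated_natCast_of_norm_eq_sq {p : ℕ} {ϖ : GaussianInt} (hp : p.Prime) (hd : ϖ ∣ (p : GaussianInt))
    (hn : ϖ.norm = (p : ℤ) ^ 2) : Associated ϖ (p : GaussianInt) := by
  obtain ⟨w, hw⟩ := hd
  have h : (p : ℤ) * p = ϖ.norm * w.norm := by
    rw [← Zsqrtd.norm_mul, ← hw, Zsqrtd.norm_natCast]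
  have hp0 : (p : ℤ) ≠ 0 := by exact_mod_cast hp.ne_zero
  have h1 : w.norm = 1 := by
    rw [hn] at h
    have : (p : ℤ) ^ 2 ≠ 0 := pow_ne_zero _ hp0
    apply mul_left_cancel₀ this
    rw [← h]; ring
  have hu : IsUnit w := Zsqrtd.norm_eq_one_iff.1 (by rw [h1]; rfl)
  exact ⟨hu.unit, hw.symm⟩

/-- An inert `p` is its own conjugate, so it divides `z` as soon as it divides the norm, and
dividing by it removes `p ^ 2` from the norm. An odd `e` would end with `p ∣ n`, so there is no such
`z`. -/
theorem exists_factorization_of_inert {p : ℕ} (hp : p.Prime) (hP : Prime (p : GaussianInt))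
    {n : ℕ} (hpn : ¬ p ∣ n) (e : ℕ) :
    ∀ z ∈ normSet (p ^ e * n), ∃ w ∈ normSet n, z = p ^ (e / 2) * w := by
  induction e using Nat.strong_induction_on with
  | _ e ih =>
    intro z hz
    rcases Nat.eq_zero_or_pos e with rfl | he
    · exact ⟨z, by simpa using hz, by simp⟩
    rw [mem_normSet] at hz
    have hp0 : (p : ℤ) ≠ 0 := by exact_mod_cast hp.ne_zero
    have hdz : (p : GaussianInt) ∣ (z.norm : GaussianInt) := by
      rw [hz]
      refine ⟨(p : GaussianInt) ^ (e - 1) * n, ?_⟩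
      push_cast
      rw [← mul_assoc, ← pow_succ', Nat.sub_add_cancel he]
    have hpz : (p : GaussianInt) ∣ z := by
      rcases dvd_or_star_dvd hP hdz with h | h
      · exact h
      · simpa using h
    obtain ⟨w, hw⟩ := hpz
    rw [hw, Zsqrtd.norm_mul, Zsqrtd.norm_natCast] at hz
    rcases Nat.lt_or_ge e 2 with h2 | h2
    · have he1 : e = 1 := by omega
      subst he1
      exfalso
      apply hpn
      have : (p : ℤ) * w.norm = n := by
        apply mul_left_cancel₀ hp0
        rw [← mul_assoc, hz]; push_cast; ring
      exact Int.natCast_dvd_natCast.1 ⟨w.norm, this.symm⟩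
    · obtain ⟨k, rfl⟩ := Nat.exists_eq_add_of_le' h2
      have hwn : w ∈ normSet (p ^ k * n) := by
        rw [mem_normSet]
        apply mul_left_cancel₀ (mul_ne_zero hp0 hp0)
        rw [hz]; push_cast; ring
      obtain ⟨v, hv, hv'⟩ := ih k (by omega) w hwn
      refine ⟨v, hv, ?_⟩
      rw [hw, hv', show (k + 2) / 2 = k / 2 + 1 by omega]; ring

/-- The factor `e + 1` counts the ways to distribute `e` between `ϖ` and its conjugate; in the inert
case there is no choice. -/
theorem ncard_normSet_prime_pow_mul_le {p : ℕ} (hp : p.Prime) {n : ℕ} (hpn : ¬ p ∣ n) (e : ℕ) :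
    (normSet (p ^ e * n)).ncard ≤ (e + 1) * (normSet n).ncard := by
  obtain ⟨ϖ, hϖ, hd, hn | hn⟩ := exists_prime_over p hp
  · have hsub : normSet (p ^ e * n) ⊆
        (fun q : ℕ × GaussianInt => ϖ ^ q.1 * star ϖ ^ (e - q.1) * q.2) ''
          ((Finset.range (e + 1) : Set ℕ) ×ˢ normSet n) := by
      intro z hz
      obtain ⟨a, ha, w, hw, rfl⟩ := exists_factorization p hp hϖ hd hn n e z hz
      exact ⟨(a, w), ⟨by simpa using Nat.lt_succ_of_le ha, hw⟩, rfl⟩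
    have hfin : ((Finset.range (e + 1) : Set ℕ) ×ˢ normSet n).Finite :=
      (Finset.finite_toSet _).prod (finite_normSet n)
    refine (Set.ncard_le_ncard hsub (hfin.image _)).trans ((Set.ncard_image_le hfin).trans ?_)
    rw [Set.ncard_prod, Set.ncard_coe_finset, Finset.card_range]
  · have hP : Prime (p : GaussianInt) := (associated_natCast_of_norm_eq_sq hp hd hn).prime hϖ
    have hsub : normSet (p ^ e * n) ⊆ (fun w : GaussianInt => p ^ (e / 2) * w) '' normSet n := by
      intro z hz
      obtain ⟨w, hw, rfl⟩ := exists_factorization_of_inert hp hP hpn e z hz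
      exact ⟨w, hw, rfl⟩
    refine (Set.ncard_le_ncard hsub ((finite_normSet n).image _)).trans
      ((Set.ncard_image_le (finite_normSet n)).trans ?_)
    exact Nat.le_mul_of_pos_left _ (Nat.succ_pos e)

/-- The crude count of the nine points of `[-1, 1]²` suffices. -/
theorem ncard_normSet_one_le : (normSet 1).ncard ≤ 9 := by
  refine (Set.ncard_le_ncard (normSet_subset 1) ((Finset.finite_toSet _).image _)).trans
    ((Set.ncard_image_le (Finset.finite_toSet _)).trans ?_)
  rw [Set.ncard_coe_finset]
  decide

theorem ncard_normSet_le (n : ℕ) (hn : n ≠ 0) :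
    (normSet n).ncard ≤ 9 * n.divisors.card := by
  induction n using Nat.recOnPrimePow with
  | zero => exact absurd rfl hn
  | one => simpa using ncard_normSet_one_le
  | prime_pow_mul a p e hp hpa he ih =>
    have ha : a ≠ 0 := by rintro rfl; simp at hpa
    have hcop : (p ^ e).Coprime a := Nat.Coprime.pow_left _ ((hp.coprime_iff_not_dvd).2 hpa)
    rw [hcop.card_divisors_mul, Nat.divisors_prime_pow hp, Finset.card_map, Finset.card_range]
    calc _ ≤ (e + 1) * (normSet a).ncard := ncard_normSet_prime_pow_mul_le hp hpa e
      _ ≤ (e + 1) * (9 * a.divisors.card) := Nat.mul_le_mul_left _ (ih ha)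
      _ = _ := by ring

end GaussianInt

/-! ### The divisor bound -/

/-- Compare `∏ (e + 1)` with `∏ p ^ (e ε)` prime by prime. If `p ^ ε ≥ 2`, then `e + 1 ≤ 2 ^ e`
loses nothing; each of the fewer than `B` smaller primes costs at most a factor `K`. -/
theorem Nat.exists_card_divisors_le_rpow {ε : ℝ} (hε : 0 < ε) :
    ∃ C : ℝ, 0 < C ∧ ∀ n : ℕ, n ≠ 0 → (n.divisors.card : ℝ) ≤ C * (n : ℝ) ^ ε := by
  obtain ⟨B, hB⟩ := exists_nat_gt ((2 : ℝ) ^ (1 / ε))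
  -- Chosen so that `e + 1 ≤ K (1 + e ε log 2) ≤ K 2 ^ (ε e)`.
  set K : ℝ := max 1 (1 / (ε * Real.log 2)) with hK
  have hK1 : 1 ≤ K := le_max_left _ _
  have hl2 : 0 < Real.log 2 := Real.log_pos (by norm_num)
  have hpow : ∀ e : ℕ, 1 + e * (ε * Real.log 2) ≤ (2 : ℝ) ^ (ε * e) := by
    intro e
    rw [Real.rpow_def_of_pos (by norm_num)]
    have := Real.add_one_le_exp (Real.log 2 * (ε * e))
    nlinarith
  have hK2 : 1 ≤ K * (ε * Real.log 2) := by
    have h : 1 / (ε * Real.log 2) ≤ K := le_max_right _ _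
    rwa [div_le_iff₀ (by positivity)] at h
  have hterm : ∀ p e : ℕ, p.Prime →
      ((e : ℝ) + 1) ≤ (if p < B then K else 1) * ((p : ℝ) ^ e) ^ ε := by
    intro p e hp
    have hp2 : (2 : ℝ) ≤ p := by exact_mod_cast hp.two_le
    rw [← Real.rpow_natCast_mul (by positivity), mul_comm (e : ℝ)]
    split_ifs with h
    · calc (e : ℝ) + 1 ≤ K * (1 + e * (ε * Real.log 2)) := by
            have he : (0 : ℝ) ≤ e := by positivity
            nlinarith
        _ ≤ K * (2 : ℝ) ^ (ε * e) := by gcongr; exact hpow e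
        _ ≤ K * (p : ℝ) ^ (ε * e) := by gcongr
    · rw [one_mul, Real.rpow_mul (by positivity)]
      have h2 : (2 : ℝ) ≤ (p : ℝ) ^ ε := by
        have hpB : (2 : ℝ) ^ (1 / ε) ≤ p := hB.le.trans (by exact_mod_cast not_lt.1 h)
        calc (2 : ℝ) = ((2 : ℝ) ^ (1 / ε)) ^ ε := by
              rw [← Real.rpow_mul (by norm_num), one_div, inv_mul_cancel₀ hε.ne', Real.rpow_one]
          _ ≤ _ := by gcongr
      calc (e : ℝ) + 1 ≤ (2 : ℝ) ^ e := by exact_mod_cast Nat.succ_le_of_lt Nat.lt_two_pow_self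
        _ ≤ ((p : ℝ) ^ ε) ^ e := by gcongr
        _ = _ := by rw [Real.rpow_natCast]
  refine ⟨K ^ B, by positivity, fun n hn => ?_⟩
  rw [Nat.card_divisors hn]
  push_cast
  have hprod : (n : ℝ) = ∏ p ∈ n.primeFactors, (p : ℝ) ^ n.factorization p := by
    conv_lhs => rw [← Nat.prod_factorization_pow_eq_self hn]
    rw [Nat.prod_factorization_eq_prod_primeFactors]
    push_cast; rfl
  calc ∏ p ∈ n.primeFactors, ((n.factorization p : ℝ) + 1)
      ≤ ∏ p ∈ n.primeFactors,
          ((if p < B then K else 1) * ((p : ℝ) ^ n.factorization p) ^ ε) :=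
        Finset.prod_le_prod (fun _ _ => by positivity)
          fun p hp => hterm p _ (Nat.prime_of_mem_primeFactors hp)
    _ = (∏ p ∈ n.primeFactors, if p < B then K else 1) * (n : ℝ) ^ ε := by
        rw [Finset.prod_mul_distrib, Real.finsetProd_rpow _ _ (fun _ _ => by positivity), ← hprod]
    _ ≤ K ^ B * (n : ℝ) ^ ε := by
        gcongr
        rw [← Finset.prod_filter, Finset.prod_const]
        refine pow_le_pow_right₀ hK1 ?_
        calc _ ≤ (Finset.range B).card := Finset.card_le_card fun p hp => by
              simp only [Finset.mem_filter] at hp; simpa using hp.2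
          _ = B := Finset.card_range B

/-! ### Lattice points on a circle inside a box -/

/-- The pairs of integers in `[K - N, K + N]²` at which `x² + y²` has the value `T`. -/
def circleBox (K : ℤ) (N : ℝ) (T : ℤ) : Set (ℤ × ℤ) :=
  {p | |(p.1 : ℝ) - K| ≤ N ∧ |(p.2 : ℝ) - K| ≤ N ∧ p.1 ^ 2 + p.2 ^ 2 = T}

theorem circleBox_subset_image (K : ℤ) (N : ℝ) (T : ℤ) :
    circleBox K N T ⊆ (fun z : GaussianInt => (z.re, z.im)) '' GaussianInt.normSet T.toNat := by
  rintro ⟨x, y⟩ ⟨-, -, h⟩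
  refine ⟨⟨x, y⟩, ?_, rfl⟩
  simp only at h
  rw [GaussianInt.mem_normSet, Zsqrtd.norm_def, Int.toNat_of_nonneg (by rw [← h]; positivity), ← h]
  ring

theorem finite_circleBox (K : ℤ) (N : ℝ) (T : ℤ) : (circleBox K N T).Finite :=
  ((GaussianInt.finite_normSet _).image _).subset (circleBox_subset_image K N T)

/-- Expanding the squares about `K`, the sums of coordinates of two points of the set, multiplied by
`2K`, differ by at most `2N² < 2|K|`. So the integer sums agree, and sum together with sum of
squares determines the pair up to order. -/
theorem ncard_circleBox_le_two {K : ℤ} {N : ℝ} (hN : N ^ 2 < |(K : ℝ)|) (T : ℤ) :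
    (circleBox K N T).ncard ≤ 2 := by
  have hsum : ∀ p ∈ circleBox K N T, ∀ q ∈ circleBox K N T, p.1 + p.2 = q.1 + q.2 := by
    rintro ⟨x, y⟩ ⟨hx, hy, h⟩ ⟨u, v⟩ ⟨hu, hv, h'⟩
    simp only at *
    by_contra hne
    have h1 : (1 : ℝ) ≤ |((x + y - (u + v) : ℤ) : ℝ)| := by
      rw [← Int.cast_abs]
      exact_mod_cast Int.one_le_abs (sub_ne_zero.2 hne)
    have e : (2 * K : ℝ) * ((x + y - (u + v) : ℤ) : ℝ) =
        ((u : ℝ) - K) ^ 2 + ((v : ℝ) - K) ^ 2 - (((x : ℝ) - K) ^ 2 + ((y : ℝ) - K) ^ 2) := by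
      have hz : (x : ℝ) ^ 2 + (y : ℝ) ^ 2 = (u : ℝ) ^ 2 + (v : ℝ) ^ 2 := by
        exact_mod_cast h.trans h'.symm
      push_cast
      linarith
    have hb : ∀ w : ℝ, |w| ≤ N → w ^ 2 ≤ N ^ 2 := fun w hw => sq_le_sq' (abs_le.1 hw).1 (abs_le.1 hw).2
    have h2 : |(2 * K : ℝ) * ((x + y - (u + v) : ℤ) : ℝ)| ≤ 2 * N ^ 2 := by
      rw [e, abs_le]
      constructor <;> linarith [hb _ hx, hb _ hy, hb _ hu, hb _ hv, sq_nonneg ((x : ℝ) - K),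
        sq_nonneg ((y : ℝ) - K), sq_nonneg ((u : ℝ) - K), sq_nonneg ((v : ℝ) - K)]
    rw [abs_mul, abs_mul, abs_two] at h2
    nlinarith [abs_nonneg (K : ℝ)]
  rcases (circleBox K N T).eq_empty_or_nonempty with h0 | ⟨⟨x, y⟩, hp⟩
  · simp [h0]
  · have hsub : circleBox K N T ⊆ (({(x, y), (y, x)} : Finset (ℤ × ℤ)) : Set (ℤ × ℤ)) := by
      rintro ⟨u, v⟩ hq
      have hs := hsum _ hp _ hq
      have hx := hp.2.2
      have hu := hq.2.2
      simp only at hs hx hu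
      have hprod : (u - x) * (u - y) = 0 := by
        have hv : v = x + y - u := by linarith
        subst hv
        nlinarith
      rcases mul_eq_zero.1 hprod with h | h
      · have h1 : u = x := by linarith
        have h2 : v = y := by linarith
        simp [h1, h2]
      · have h1 : u = y := by linarith
        have h2 : v = x := by linarith
        simp [h1, h2]
    refine (Set.ncard_le_ncard hsub (Finset.finite_toSet _)).trans ?_
    rw [Set.ncard_coe_finset]
    exact Finset.card_le_two

/-- The constant must not depend on `K`. Far boxes, `|K| > N²`, contain at most two points;
otherwise `T ≤ 8 N⁴` and the divisor bound with exponent `ε / 4` applies. -/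
theorem exists_ncard_circleBox_le {ε : ℝ} (hε : 0 < ε) :
    ∃ C : ℝ, 0 < C ∧ ∀ (K : ℤ) (N : ℝ) (T : ℤ), 1 ≤ N →
      ((circleBox K N T).ncard : ℝ) ≤ C * N ^ ε := by
  obtain ⟨C, hC, h⟩ := Nat.exists_card_divisors_le_rpow (ε := ε / 4) (by positivity)
  refine ⟨9 * C * 8 ^ (ε / 4) + 2, by positivity, fun K N T hN => ?_⟩
  have hNε : 1 ≤ N ^ ε := Real.one_le_rpow hN hε.le
  have hN0 : 0 < N := by linarith
  rcases lt_or_ge (N ^ 2) |(K : ℝ)| with hK | hK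
  · have h2 : ((circleBox K N T).ncard : ℝ) ≤ 2 := by exact_mod_cast ncard_circleBox_le_two hK T
    have : 0 < 9 * C * 8 ^ (ε / 4) := by positivity
    nlinarith
  rcases (circleBox K N T).eq_empty_or_nonempty with h0 | ⟨⟨x, y⟩, hx, hy, hp⟩
  · rw [h0]; simp; positivity
  simp only at hx hy hp
  have hbd : ∀ w : ℝ, |w - K| ≤ N → w ^ 2 ≤ 4 * N ^ 4 := by
    intro w hw
    have h1 : |w| ≤ 2 * N ^ 2 := by
      have := abs_sub_abs_le_abs_sub w (K : ℝ)
      nlinarith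
    calc w ^ 2 = |w| ^ 2 := (sq_abs w).symm
      _ ≤ (2 * N ^ 2) ^ 2 := by gcongr
      _ = _ := by ring
  have hT : (T : ℝ) ≤ 8 * N ^ 4 := by
    have hp' : (x : ℝ) ^ 2 + (y : ℝ) ^ 2 = T := by exact_mod_cast hp
    linarith [hbd _ hx, hbd _ hy]
  have hT0 : 0 ≤ T := by rw [← hp]; positivity
  have hcard : (circleBox K N T).ncard ≤ (GaussianInt.normSet T.toNat).ncard :=
    (Set.ncard_le_ncard (circleBox_subset_image K N T) ((GaussianInt.finite_normSet _).image _)).trans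
      (Set.ncard_image_le (GaussianInt.finite_normSet _))
  -- The divisor bound excludes norm zero, where the origin is the only point.
  rcases eq_or_ne T.toNat 0 with h0 | h0
  · have h1 : (GaussianInt.normSet T.toNat) ⊆ {0} := by
      intro z hz
      rw [GaussianInt.mem_normSet, h0] at hz
      simpa using GaussianInt.norm_eq_zero.1 (by simpa using hz)
    have h2 : (circleBox K N T).ncard ≤ 1 :=
      hcard.trans ((Set.ncard_le_ncard h1).trans (by simp))
    have h3 : ((circleBox K N T).ncard : ℝ) ≤ 1 := by exact_mod_cast h2
    have : 0 < 9 * C * 8 ^ (ε / 4) := by positivity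
    nlinarith
  · have hTn : ((T.toNat : ℕ) : ℝ) ≤ 8 * N ^ 4 := by
      have : ((T.toNat : ℕ) : ℝ) = (T : ℝ) := by exact_mod_cast Int.toNat_of_nonneg hT0
      rwa [this]
    calc ((circleBox K N T).ncard : ℝ) ≤ 9 * (T.toNat.divisors.card : ℝ) := by
          exact_mod_cast hcard.trans (GaussianInt.ncard_normSet_le _ h0)
      _ ≤ 9 * (C * ((T.toNat : ℕ) : ℝ) ^ (ε / 4)) := by gcongr; exact h _ h0
      _ ≤ 9 * (C * (8 * N ^ 4) ^ (ε / 4)) := by gcongr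
      _ = 9 * C * 8 ^ (ε / 4) * N ^ ε := by
          rw [Real.mul_rpow (by norm_num) (by positivity), ← Real.rpow_natCast_mul hN0.le]
          push_cast
          rw [mul_div_cancel₀ ε (by norm_num : (4 : ℝ) ≠ 0)]
          ring
      _ ≤ _ := by nlinarith

/-! ### Counting integers and lattice points by length and area -/

theorem Int.count_Icc_le (a b : ℝ) :
    Measure.count {n : ℤ | (n : ℝ) ∈ Set.Icc a b} ≤ ENNReal.ofReal (b - a) + 1 := by
  have hs : {n : ℤ | (n : ℝ) ∈ Set.Icc a b} = ((Finset.Icc ⌈a⌉ ⌊b⌋ : Finset ℤ) : Set ℤ) := by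
    ext n
    simp [Int.ceil_le, Int.le_floor]
  rw [hs, Measure.count_apply_finset, Int.card_Icc, ← ENNReal.ofReal_one]
  rcases le_total (⌊b⌋ + 1 - ⌈a⌉) 0 with h | h
  · rw [Int.toNat_of_nonpos h]; simp
  · have hab : 0 ≤ b - a ∨ b - a < 0 := le_or_gt _ _
    rcases hab with hab | hab
    · rw [← ENNReal.ofReal_add hab zero_le_one, ← ENNReal.ofReal_natCast]
      apply ENNReal.ofReal_le_ofReal
      have h1 : ((⌊b⌋ + 1 - ⌈a⌉).toNat : ℝ) = ((⌊b⌋ + 1 - ⌈a⌉ : ℤ) : ℝ) := by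
        exact_mod_cast Int.toNat_of_nonneg h
      rw [h1]; push_cast
      linarith [Int.floor_le b, Int.le_ceil a]
    · have h2 : ((⌊b⌋ + 1 - ⌈a⌉).toNat) ≤ 1 := by
        have : ⌊b⌋ ≤ ⌈a⌉ := (Int.floor_mono (by linarith : b ≤ a)).trans (Int.floor_le_ceil a)
        omega
      calc (((⌊b⌋ + 1 - ⌈a⌉).toNat : ℕ) : ℝ≥0∞) ≤ 1 := by exact_mod_cast h2
        _ ≤ _ := by simp

/-- `J` lies between the open and the closed interval with the same endpoints, which have equal
length. -/
theorem Int.count_ordConnected_le {J : Set ℝ} (hJ : J.OrdConnected) (hb : Bornology.IsBounded J) :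
    Measure.count {n : ℤ | (n : ℝ) ∈ J} ≤ volume J + 1 := by
  rcases J.eq_empty_or_nonempty with rfl | hne
  · simp
  have hsub : J ⊆ Set.Icc (sInf J) (sSup J) := subset_Icc_csInf_csSup hb.bddBelow hb.bddAbove
  have hsub' : Set.Ioo (sInf J) (sSup J) ⊆ J :=
    IsConnected.Ioo_csInf_csSup_subset ⟨hne, hJ.isPreconnected⟩ hb.bddBelow hb.bddAbove
  calc Measure.count {n : ℤ | (n : ℝ) ∈ J}
      ≤ Measure.count {n : ℤ | (n : ℝ) ∈ Set.Icc (sInf J) (sSup J)} :=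
        measure_mono fun n hn => hsub hn
    _ ≤ ENNReal.ofReal (sSup J - sInf J) + 1 := Int.count_Icc_le _ _
    _ = volume (Set.Ioo (sInf J) (sSup J)) + 1 := by rw [Real.volume_Ioo]
    _ ≤ _ := by gcongr

/-- The part of an interval on which `y ^ 2` lies in `[A, B]` consists of two intervals. -/
theorem Int.count_sq_mem_Icc_le (a b A B : ℝ) :
    Measure.count {n : ℤ | (n : ℝ) ∈ Set.Icc a b ∧ (n : ℝ) ^ 2 ∈ Set.Icc A B} ≤
      volume {y : ℝ | y ∈ Set.Icc a b ∧ y ^ 2 ∈ Set.Icc A B} + 2 := by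
  set E : Set ℝ := {y : ℝ | y ∈ Set.Icc a b ∧ y ^ 2 ∈ Set.Icc A B} with hE
  have hEb : Bornology.IsBounded E := (Metric.isBounded_Icc a b).subset fun y hy => hy.1
  have h1 : (E ∩ Set.Ici 0).OrdConnected := by
    refine ⟨fun x hx y hy z hz => ?_⟩
    obtain ⟨⟨⟨_, _⟩, _, _⟩, hx0⟩ := hx
    obtain ⟨⟨⟨_, _⟩, _, _⟩, hy0⟩ := hy
    obtain ⟨_, _⟩ := hz
    simp only [Set.mem_Ici] at hx0 hy0
    refine ⟨⟨⟨?_, ?_⟩, ?_, ?_⟩, Set.mem_Ici.2 (by linarith)⟩ <;> nlinarith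
  have h2 : (E ∩ Set.Iio 0).OrdConnected := by
    refine ⟨fun x hx y hy z hz => ?_⟩
    obtain ⟨⟨⟨_, _⟩, _, _⟩, hx0⟩ := hx
    obtain ⟨⟨⟨_, _⟩, _, _⟩, hy0⟩ := hy
    obtain ⟨_, _⟩ := hz
    simp only [Set.mem_Iio] at hx0 hy0
    refine ⟨⟨⟨?_, ?_⟩, ?_, ?_⟩, Set.mem_Iio.2 (by linarith)⟩ <;> nlinarith
  have hu : {n : ℤ | (n : ℝ) ∈ E} ⊆
      {n : ℤ | (n : ℝ) ∈ E ∩ Set.Ici 0} ∪ {n : ℤ | (n : ℝ) ∈ E ∩ Set.Iio 0} := by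
    intro n hn
    rcases le_or_gt (0 : ℝ) (n : ℝ) with h | h
    · exact Or.inl ⟨hn, h⟩
    · exact Or.inr ⟨hn, h⟩
  have hv : volume (E ∩ Set.Ici 0) + volume (E ∩ Set.Iio 0) = volume E := by
    have := measure_inter_add_sdiff (μ := (volume : Measure ℝ)) E (measurableSet_Ici (a := (0 : ℝ)))
    rwa [Set.sdiff_eq, Set.compl_Ici] at this
  calc Measure.count {n : ℤ | (n : ℝ) ∈ E}
      ≤ (volume (E ∩ Set.Ici 0) + 1) + (volume (E ∩ Set.Iio 0) + 1) :=
        (measure_mono hu).trans ((measure_union_le _ _).trans (add_le_add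
          (Int.count_ordConnected_le h1 (hEb.subset Set.inter_subset_left))
          (Int.count_ordConnected_le h2 (hEb.subset Set.inter_subset_left))))
    _ = _ := by rw [← hv]; ring

theorem volume_annulus_le (A H : ℝ) (hH : 0 ≤ H) :
    volume {p : ℝ × ℝ | p.1 ^ 2 + p.2 ^ 2 ∈ Set.Icc A (A + H)} ≤ ENNReal.ofReal (π * H) := by
  have hmp := Complex.volume_preserving_equiv_real_prod
  set S : Set (ℝ × ℝ) := {p : ℝ × ℝ | p.1 ^ 2 + p.2 ^ 2 ∈ Set.Icc A (A + H)} with hS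
  have hpre : Complex.measurableEquivRealProd ⁻¹' S ⊆
      Metric.closedBall (0 : ℂ) √(A + H) \ Metric.ball 0 √A := by
    intro z hz
    have hz' : Complex.normSq z ∈ Set.Icc A (A + H) := by
      have : z.re ^ 2 + z.im ^ 2 ∈ Set.Icc A (A + H) := hz
      rwa [Complex.normSq_apply, ← sq, ← sq]
    rw [Complex.normSq_eq_norm_sq] at hz'
    refine ⟨?_, ?_⟩
    · rw [mem_closedBall_zero_iff]; exact Real.le_sqrt_of_sq_le hz'.2
    · rw [mem_ball_zero_iff, not_lt]; exact Real.sqrt_le_iff.2 ⟨norm_nonneg _, hz'.1⟩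
  rw [← hmp.measure_preimage_equiv S]
  refine (measure_mono hpre).trans ?_
  rcases lt_or_ge (A + H) 0 with hA | hA
  · have h0 : √(A + H) = 0 := Real.sqrt_eq_zero_of_nonpos hA.le
    refine (measure_mono Set.sdiff_subset).trans ?_
    rw [Complex.volume_closedBall, h0]
    simp
  · have hle : Metric.ball (0 : ℂ) √A ⊆ Metric.closedBall 0 √(A + H) :=
      (Metric.ball_subset_ball (Real.sqrt_le_sqrt (by linarith))).trans Metric.ball_subset_closedBall
    rw [measure_sdiff hle measurableSet_ball.nullMeasurableSet measure_ball_lt_top.ne,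
      Complex.volume_closedBall, Complex.volume_ball, ← ENNReal.ofReal_pow (Real.sqrt_nonneg _),
      ← ENNReal.ofReal_pow (Real.sqrt_nonneg _), Real.sq_sqrt hA]
    have hpi : (NNReal.pi : ℝ≥0∞) = ENNReal.ofReal π := by
      rw [ENNReal.ofReal, Real.toNNReal_of_nonneg Real.pi_pos.le]; rfl
    rw [hpi, ← ENNReal.ofReal_mul hA, ← ENNReal.ofReal_mul (by positivity), ← ENNReal.ofReal_sub _
      (by positivity)]
    -- For negative `A` the inner disc is empty and `√A = 0`, so only `A ≤ √A ^ 2` is available;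
    -- this is the needed direction.
    apply ENNReal.ofReal_le_ofReal
    have : A ≤ √A ^ 2 := by
      rcases le_total 0 A with h | h
      · rw [Real.sq_sqrt h]
      · exact h.trans (sq_nonneg _)
    nlinarith [Real.pi_pos]

theorem count_eq_tsum {α : Type*} [MeasurableSpace α] [MeasurableSingletonClass α] [Countable α]
    (s : Set α) : Measure.count s = ∑' x, s.indicator (1 : α → ℝ≥0∞) x := by
  have hs : MeasurableSet s := s.to_countable.measurableSet
  rw [← lintegral_count, lintegral_indicator_one hs]

theorem indicator_one_le_of_imp {α β : Type*} {s : Set α} {t : Set β} {x : α} {y : β}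
    (h : x ∈ s → y ∈ t) : s.indicator (1 : α → ℝ≥0∞) x ≤ t.indicator (1 : β → ℝ≥0∞) y := by
  by_cases hx : x ∈ s
  · rw [Set.indicator_of_mem hx, Set.indicator_of_mem (h hx)]; simp
  · rw [Set.indicator_of_notMem hx]; exact zero_le

/-- Lattice points in the part of an annulus in a box, counted by the area of the annulus. -/
theorem count_annulus_le (a b A H : ℝ) (hab : a ≤ b) (hH : 0 ≤ H) :
    Measure.count {p : ℤ × ℤ | (p.1 : ℝ) ∈ Set.Icc a b ∧ (p.2 : ℝ) ∈ Set.Icc a b ∧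
      (p.1 : ℝ) ^ 2 + (p.2 : ℝ) ^ 2 ∈ Set.Icc A (A + H)} ≤
      ENNReal.ofReal (4 * (b - a) + 2 + π * H) := by
  set I : Set ℝ := Set.Icc a b
  -- the slice of the annulus at height `x`
  set E : ℝ → Set ℝ := fun x => {y | y ∈ I ∧ y ^ 2 ∈ Set.Icc (A - x ^ 2) (A + H - x ^ 2)} with hE
  have hEm : ∀ x, MeasurableSet (E x) := fun x => by
    refine measurableSet_Icc.inter (measurableSet_Icc.preimage ?_)
    fun_prop
  -- The annulus is symmetric in its coordinates. So the sum over integers `m` of the lengths of the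
  -- slices `E m` becomes, by Tonelli, an integral over `y` of integer counts in `E y`, and the
  -- one-dimensional count can be used a second time.
  have hEswap : ∀ x y, x ∈ I → y ∈ E x → x ∈ E y := by
    intro x y hx hy
    obtain ⟨hy1, hy2, hy3⟩ := hy
    exact ⟨hx, by linarith, by linarith⟩
  have hcount : ∀ x, Measure.count {n : ℤ | (n : ℝ) ∈ E x} ≤ volume (E x) + 2 := fun x =>
    Int.count_sq_mem_Icc_le _ _ _ _
  have hI : Measure.count {n : ℤ | (n : ℝ) ∈ I} ≤ ENNReal.ofReal (b - a) + 1 := Int.count_Icc_le a b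
  have h1 : Measure.count {p : ℤ × ℤ | (p.1 : ℝ) ∈ I ∧ (p.2 : ℝ) ∈ I ∧
      (p.1 : ℝ) ^ 2 + (p.2 : ℝ) ^ 2 ∈ Set.Icc A (A + H)} ≤
      ∑' m : ℤ, {m : ℤ | (m : ℝ) ∈ I}.indicator (fun m => volume (E m) + 2) m := by
    rw [count_eq_tsum, ENNReal.tsum_prod']
    refine ENNReal.tsum_le_tsum fun m => ?_
    by_cases hm : (m : ℝ) ∈ I
    · rw [Set.indicator_of_mem (by exact hm)]
      refine le_trans ?_ (hcount m)
      rw [count_eq_tsum]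
      exact ENNReal.tsum_le_tsum fun n => indicator_one_le_of_imp fun hn =>
        ⟨hn.2.1, by linarith [hn.2.2.1], by linarith [hn.2.2.2]⟩
    · rw [ENNReal.tsum_eq_zero.2]
      · exact zero_le
      · exact fun n => Set.indicator_of_notMem (fun h => hm h.1) _
  have h2 : ∑' m : ℤ, {m : ℤ | (m : ℝ) ∈ I}.indicator (fun m => volume (E m) + 2) m =
      (∑' m : ℤ, {m : ℤ | (m : ℝ) ∈ I}.indicator (fun m => volume (E m)) m) +
        Measure.count {n : ℤ | (n : ℝ) ∈ I} * 2 := by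
    rw [count_eq_tsum, ← ENNReal.tsum_mul_right, ← ENNReal.tsum_add]
    refine tsum_congr fun m => ?_
    by_cases hm : (m : ℝ) ∈ I
    · simp [hm]
    · simp [hm]
  have h3 : (∑' m : ℤ, {m : ℤ | (m : ℝ) ∈ I}.indicator (fun m => volume (E m)) m) ≤
      ∫⁻ y in I, (volume (E y) + 2) := by
    calc (∑' m : ℤ, {m : ℤ | (m : ℝ) ∈ I}.indicator (fun m => volume (E m)) m)
        = ∑' m : ℤ, ∫⁻ y, {m : ℤ | (m : ℝ) ∈ I}.indicator
            (fun m => (E m).indicator (1 : ℝ → ℝ≥0∞) y) m := by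
          refine tsum_congr fun m => ?_
          by_cases hm : (m : ℝ) ∈ I
          · simp [hm, lintegral_indicator_one (hEm m)]
          · simp [hm]
      _ = ∫⁻ y, ∑' m : ℤ, {m : ℤ | (m : ℝ) ∈ I}.indicator
            (fun m => (E m).indicator (1 : ℝ → ℝ≥0∞) y) m := by
          rw [lintegral_tsum]
          intro m
          by_cases hm : (m : ℝ) ∈ I
          · simp only [Set.mem_ofPred_eq, hm, Set.indicator_of_mem]
            exact (measurable_one.indicator (hEm m)).aemeasurable
          · simp [hm]
      _ ≤ ∫⁻ y, I.indicator (fun y => volume (E y) + 2) y := by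
          refine lintegral_mono fun y => ?_
          by_cases hy : y ∈ I
          · rw [Set.indicator_of_mem hy]
            refine le_trans ?_ (hcount y)
            rw [count_eq_tsum]
            refine ENNReal.tsum_le_tsum fun m => ?_
            by_cases hm : (m : ℝ) ∈ I
            · rw [Set.indicator_of_mem (by exact hm)]
              exact indicator_one_le_of_imp (hEswap _ _ hm)
            · rw [Set.indicator_of_notMem (by exact hm)]; exact zero_le
          · rw [Set.indicator_of_notMem hy]
            refine (ENNReal.tsum_eq_zero.2 fun m => ?_).le
            by_cases hm : (m : ℝ) ∈ I
            · rw [Set.indicator_of_mem (by exact hm), Set.indicator_of_notMem (fun h => hy h.1)]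
            · rw [Set.indicator_of_notMem (by exact hm)]
      _ = _ := lintegral_indicator measurableSet_Icc _
  have h4 : ∫⁻ y in I, (volume (E y) + 2) ≤
      ENNReal.ofReal (π * H) + 2 * ENNReal.ofReal (b - a) := by
    rw [lintegral_add_right _ measurable_const, setLIntegral_const, Real.volume_Icc]
    gcongr
    refine le_trans (setLIntegral_le_lintegral _ _) (le_trans ?_ (volume_annulus_le A H hH))
    have hm : MeasurableSet {p : ℝ × ℝ | p.1 ^ 2 + p.2 ^ 2 ∈ Set.Icc A (A + H)} :=
      measurableSet_Icc.preimage (by fun_prop)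
    rw [Measure.volume_eq_prod, Measure.prod_apply hm]
    refine lintegral_mono fun x => measure_mono fun y hy => ?_
    exact ⟨by linarith [hy.2.1], by linarith [hy.2.2]⟩
  have hba : 0 ≤ b - a := by linarith
  calc _ ≤ (ENNReal.ofReal (π * H) + 2 * ENNReal.ofReal (b - a)) +
        (ENNReal.ofReal (b - a) + 1) * 2 :=
        h1.trans (h2.le.trans (add_le_add (h3.trans h4) (mul_le_mul_left hI 2)))
    _ = ENNReal.ofReal (4 * (b - a) + 2 + π * H) := by
        have e2 : (2 : ℝ≥0∞) = ENNReal.ofReal 2 := by simp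
        have hpH : 0 ≤ π * H := by positivity
        rw [e2, ← ENNReal.ofReal_one, ← ENNReal.ofReal_mul (by norm_num),
          ← ENNReal.ofReal_add hba zero_le_one, ← ENNReal.ofReal_mul (by linarith),
          ← ENNReal.ofReal_add hpH (by linarith), ← ENNReal.ofReal_add (by linarith) (by linarith)]
        congr 1; ring

/-! ### Slices of thin annuli at integral heights -/

theorem measurableSet_prod_of_countable {α β : Type*} [MeasurableSpace α] [MeasurableSpace β]
    [Countable β] [MeasurableSingletonClass β] {W : Set (α × β)}
    (h : ∀ q, MeasurableSet {x | (x, q) ∈ W}) : MeasurableSet W := by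
  have hW : W = ⋃ q, {x | (x, q) ∈ W} ×ˢ {q} := by
    ext ⟨x, q⟩
    simp
  rw [hW]
  exact MeasurableSet.iUnion fun q => (h q).prod (measurableSet_singleton q)

theorem prod_count_apply {α β : Type*} [MeasurableSpace α] [MeasurableSpace β]
    [Countable β] [MeasurableSingletonClass β] {μ : Measure α} [SFinite μ] {W : Set (α × β)}
    (h : ∀ q, MeasurableSet {x | (x, q) ∈ W}) :
    (μ.prod Measure.count) W = ∑' q, μ {x | (x, q) ∈ W} := by
  rw [Measure.prod_apply_symm (measurableSet_prod_of_countable h), lintegral_count]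
  rfl

theorem volume_abs_sq_sub_le (v : ℝ) :
    volume {z : ℝ | |z ^ 2 - v| ≤ 2} ≤ ENNReal.ofReal (2 * (√(v + 2) - √(v - 2))) := by
  have hsub : {z : ℝ | |z ^ 2 - v| ≤ 2} ⊆
      Set.Icc (√(v - 2)) (√(v + 2)) ∪ Set.Icc (-√(v + 2)) (-√(v - 2)) := by
    intro z hz
    have hz' := abs_le.1 (show |z ^ 2 - v| ≤ 2 from hz)
    have h1 : √(v - 2) ≤ |z| := Real.sqrt_le_iff.2 ⟨abs_nonneg z, by rw [sq_abs]; linarith⟩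
    have h2 : |z| ≤ √(v + 2) := Real.le_sqrt_of_sq_le (by rw [sq_abs]; linarith)
    rcases le_total 0 z with h | h
    · rw [abs_of_nonneg h] at h1 h2
      exact Or.inl ⟨h1, h2⟩
    · rw [abs_of_nonpos h] at h1 h2
      exact Or.inr ⟨by linarith, by linarith⟩
  refine (measure_mono hsub).trans ((measure_union_le _ _).trans ?_)
  have h0 : 0 ≤ √(v + 2) - √(v - 2) := sub_nonneg.2 (Real.sqrt_le_sqrt (by linarith))
  rw [Real.volume_Icc, Real.volume_Icc, ← ENNReal.ofReal_add h0 (by linarith)]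
  apply ENNReal.ofReal_le_ofReal
  linarith

theorem sqrt_sub_sqrt_le_two (v : ℝ) : √(v + 2) - √(v - 2) ≤ 2 := by
  have h : √(v + 2) ≤ √(v - 2) + 2 := by
    apply Real.sqrt_le_iff.2
    refine ⟨by positivity, ?_⟩
    have h1 : v - 2 ≤ √(v - 2) ^ 2 := by
      rcases le_total 0 (v - 2) with h | h
      · rw [Real.sq_sqrt h]
      · exact h.trans (sq_nonneg _)
    nlinarith [Real.sqrt_nonneg (v - 2)]
  linarith

/-- The difference times the sum of the two roots is at most `4`, and the sum is at least `√D`. -/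
theorem sqrt_sub_sqrt_le_div {v D : ℝ} (hD : 0 < D) (h : D ≤ v + 2) :
    √(v + 2) - √(v - 2) ≤ 4 / √D := by
  have hs : 0 < √D := Real.sqrt_pos.2 hD
  rw [le_div_iff₀ hs]
  have h1 : v - 2 ≤ √(v - 2) ^ 2 := by
    rcases le_total 0 (v - 2) with h | h
    · rw [Real.sq_sqrt h]
    · exact h.trans (sq_nonneg _)
  have h2 : √(v + 2) ^ 2 = v + 2 := Real.sq_sqrt (by linarith)
  have h3 : √D ≤ √(v + 2) := Real.sqrt_le_sqrt h
  have h4 : √(v - 2) ≤ √(v + 2) := Real.sqrt_le_sqrt (by linarith)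
  nlinarith [Real.sqrt_nonneg (v - 2)]

/-- Telescoping: each term is at most `2 (√(j + 1) - √j)`. -/
theorem sum_one_div_sqrt_le (m : ℕ) :
    ∑ j ∈ Finset.range m, 1 / √((j : ℝ) + 1) ≤ 2 * √m := by
  induction m with
  | zero => simp
  | succ m ih =>
    rw [Finset.sum_range_succ]
    have h1 : 0 < √((m : ℝ) + 1) := Real.sqrt_pos.2 (by positivity)
    have h2 : √((m : ℝ) + 1) ^ 2 = (m : ℝ) + 1 := Real.sq_sqrt (by positivity)
    have h3 : √(m : ℝ) ^ 2 = (m : ℝ) := Real.sq_sqrt (by positivity)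
    have h4 : 1 / √((m : ℝ) + 1) ≤ 2 * √((m : ℝ) + 1) - 2 * √(m : ℝ) := by
      rw [div_le_iff₀ h1]
      nlinarith [sq_nonneg (√((m : ℝ) + 1) - √(m : ℝ))]
    push_cast
    linarith

/-- Majorant for the measure of the slice at height `i` of a thin elliptic annulus with integral
radius `m`. -/
noncomputable def sliceBound (m i : ℕ) : ℝ :=
  if m < i then 0 else if i = m then 4 else 8 / √(((m - i : ℕ) : ℝ) * m)

theorem sliceBound_nonneg (m i : ℕ) : 0 ≤ sliceBound m i := by
  unfold sliceBound
  split_ifs <;> positivity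

/-- Below the top height, `S + 2 - i² ≥ m² - i² ≥ (m - i) m`, which bounds the difference of roots;
at `i = m` the slice may be tangential and only the trivial bound is used; above it the slice is
empty. -/
theorem volume_slice_le (S : ℝ) (i : ℕ) :
    volume {z : ℝ | |z ^ 2 + (i : ℝ) ^ 2 - S| ≤ 2} ≤
      ENNReal.ofReal (sliceBound ⌊√(S + 2)⌋₊ i) := by
  set m := ⌊√(S + 2)⌋₊ with hm
  have hset : {z : ℝ | |z ^ 2 + (i : ℝ) ^ 2 - S| ≤ 2} = {z : ℝ | |z ^ 2 - (S - (i : ℝ) ^ 2)| ≤ 2} := by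
    ext z
    simp only [Set.mem_ofPred_eq]
    rw [show z ^ 2 + (i : ℝ) ^ 2 - S = z ^ 2 - (S - (i : ℝ) ^ 2) by ring]
  unfold sliceBound
  split_ifs with h1 h2
  · have : {z : ℝ | |z ^ 2 + (i : ℝ) ^ 2 - S| ≤ 2} = ∅ := by
      rw [Set.eq_empty_iff_forall_notMem]
      intro z hz
      have hz' := abs_le.1 (show |z ^ 2 + (i : ℝ) ^ 2 - S| ≤ 2 from hz)
      have : √(S + 2) < i := Nat.lt_of_floor_lt h1
      rw [Real.sqrt_lt' (lt_of_le_of_lt (Real.sqrt_nonneg _) this)] at this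
      nlinarith [sq_nonneg z]
    rw [this]; simp
  · rw [hset]
    refine (volume_abs_sq_sub_le _).trans (ENNReal.ofReal_le_ofReal ?_)
    linarith [sqrt_sub_sqrt_le_two (S - (i : ℝ) ^ 2)]
  · rw [hset]
    refine (volume_abs_sq_sub_le _).trans (ENNReal.ofReal_le_ofReal ?_)
    have him : i < m := by omega
    have hmQ : (m : ℝ) ≤ √(S + 2) := Nat.floor_le (Real.sqrt_nonneg _)
    have hm0 : (0 : ℝ) < m := by exact_mod_cast (by omega : 0 < m)
    have hS : 0 ≤ S + 2 := by
      by_contra hneg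
      rw [Real.sqrt_eq_zero_of_nonpos (by linarith)] at hmQ
      linarith
    have hmS : (m : ℝ) ^ 2 ≤ S + 2 := by
      rw [← Real.sq_sqrt hS]; gcongr
    have hcast : ((m - i : ℕ) : ℝ) = (m : ℝ) - i := Nat.cast_sub him.le
    have hi : (i : ℝ) < m := by exact_mod_cast him
    have hi0 : (0 : ℝ) ≤ i := by positivity
    have h := sqrt_sub_sqrt_le_div (v := S - (i : ℝ) ^ 2) (D := ((m - i : ℕ) : ℝ) * m)
      (by rw [hcast]; nlinarith) (by rw [hcast]; nlinarith)
    calc 2 * (√(S - (i : ℝ) ^ 2 + 2) - √(S - (i : ℝ) ^ 2 - 2))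
        ≤ 2 * (4 / √(((m - i : ℕ) : ℝ) * m)) := by gcongr
      _ = _ := by ring

/-- The sum of `1 / √j` for `j ≤ m` is at most `2 √m`, which cancels the prefactor `8 / √m`: this
gives `16`, plus `4` for the top slice. -/
theorem tsum_sliceBound_le (m : ℕ) : ∑' i, ENNReal.ofReal (sliceBound m i) ≤ 20 := by
  rw [tsum_eq_sum (s := Finset.range (m + 1)) fun i hi => by
    have : m < i := by simpa using hi
    simp [sliceBound, this]]
  rw [← ENNReal.ofReal_sum_of_nonneg fun i _ => sliceBound_nonneg m i]
  rw [show (20 : ℝ≥0∞) = ENNReal.ofReal 20 by simp]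
  apply ENNReal.ofReal_le_ofReal
  rw [Finset.sum_range_succ, ← Finset.sum_range_reflect]
  have h1 : sliceBound m m = 4 := by simp [sliceBound]
  have h2 : ∑ j ∈ Finset.range m, sliceBound m (m - 1 - j) =
      8 / √m * ∑ j ∈ Finset.range m, 1 / √((j : ℝ) + 1) := by
    rw [Finset.mul_sum]
    refine Finset.sum_congr rfl fun j hj => ?_
    have hj' : j < m := by simpa using hj
    have e : m - (m - 1 - j) = j + 1 := by omega
    rw [sliceBound, if_neg (by omega), if_neg (by omega), e, Real.sqrt_mul (by positivity)]
    push_cast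
    field_simp
  rw [h1, h2]
  rcases Nat.eq_zero_or_pos m with rfl | hm
  · simp; norm_num
  · have hs : 0 < √(m : ℝ) := Real.sqrt_pos.2 (by exact_mod_cast hm)
    have : 8 / √(m : ℝ) * ∑ j ∈ Finset.range m, 1 / √((j : ℝ) + 1) ≤ 8 / √(m : ℝ) * (2 * √m) := by
      gcongr; exact sum_one_div_sqrt_le m
    have e : 8 / √(m : ℝ) * (2 * √m) = 16 := by field_simp; norm_num
    linarith

/-- The total length of the horizontal slices at integral heights of a thin annulus is bounded,
whatever the radius. -/
theorem tsum_volume_annulus_slice_le (S : ℝ) :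
    ∑' q : ℤ, volume {z : ℝ | |z ^ 2 + (q : ℝ) ^ 2 - S| ≤ 2} ≤ 40 := by
  set m := ⌊√(S + 2)⌋₊
  have hle : ∀ q : ℤ, volume {z : ℝ | |z ^ 2 + (q : ℝ) ^ 2 - S| ≤ 2} ≤
      ENNReal.ofReal (sliceBound m q.natAbs) := by
    intro q
    have h : ((q.natAbs : ℕ) : ℝ) ^ 2 = (q : ℝ) ^ 2 := by
      rw [Nat.cast_natAbs, Int.cast_abs, sq_abs]
    rw [← h]
    exact volume_slice_le S _
  refine (ENNReal.tsum_le_tsum hle).trans ?_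
  rw [tsum_of_nat_of_neg_add_one ENNReal.summable ENNReal.summable]
  calc _ ≤ (20 : ℝ≥0∞) + 20 := by
        refine add_le_add (by simpa using tsum_sliceBound_le m) ?_
        refine le_trans ?_ (tsum_sliceBound_le m)
        refine le_trans (le_of_eq ?_) (ENNReal.tsum_comp_le_tsum_of_injective
          (f := fun n : ℕ => n + 1) (fun a b h => by simpa using h)
          (fun i => ENNReal.ofReal (sliceBound m i)))
        refine tsum_congr fun n => ?_
        have : (-((n : ℤ) + 1)).natAbs = n + 1 := by omega
        simp only [this]
    _ = 40 := by norm_num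

/-- The substitution `z = 2x` makes the ellipse a circle; its Jacobian `1/2` is discarded. -/
theorem tsum_volume_ellipse_slice_le (p T : ℝ) :
    ∑' q : ℤ, volume {x : ℝ | |2 * x ^ 2 + (p ^ 2 + (q : ℝ) ^ 2) / 2 - T| ≤ 1} ≤ 40 := by
  refine le_trans (ENNReal.tsum_le_tsum fun q => ?_) (tsum_volume_annulus_slice_le (2 * T - p ^ 2))
  have : {x : ℝ | |2 * x ^ 2 + (p ^ 2 + (q : ℝ) ^ 2) / 2 - T| ≤ 1} =
      (fun x => 2 * x) ⁻¹' {z : ℝ | |z ^ 2 + (q : ℝ) ^ 2 - (2 * T - p ^ 2)| ≤ 2} := by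
    ext x
    simp only [Set.mem_ofPred_eq, Set.mem_preimage]
    rw [show (2 * x) ^ 2 + (q : ℝ) ^ 2 - (2 * T - p ^ 2) =
      2 * (2 * x ^ 2 + (p ^ 2 + (q : ℝ) ^ 2) / 2 - T) by ring, abs_mul, abs_two]
    constructor <;> intro h <;> linarith
  rw [this, Real.volume_preimage_mul_left two_ne_zero]
  refine mul_le_of_le_one_left zero_le ?_
  rw [ENNReal.ofReal_le_one, abs_of_pos (by norm_num)]
  norm_num

/-- The measure of the part of a thin ellipsoidal annulus over a strip `|m + n - c| ≤ ℓ`. -/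
theorem tsum_volume_strip_le (c ℓ T : ℝ) :
    ∑' q : ℤ × ℤ, volume {x : ℝ | |(q.1 : ℝ) + q.2 - c| ≤ ℓ ∧
      |2 * x ^ 2 + (q.1 : ℝ) ^ 2 + (q.2 : ℝ) ^ 2 - T| ≤ 1} ≤
      40 * (ENNReal.ofReal (2 * ℓ) + 1) := by
  set h : ℤ × ℤ → ℝ≥0∞ := fun r => volume {x : ℝ | (r.1 : ℝ) ∈ Set.Icc (c - ℓ) (c + ℓ) ∧
    |2 * x ^ 2 + ((r.1 : ℝ) ^ 2 + (r.2 : ℝ) ^ 2) / 2 - T| ≤ 1} with hh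
  -- In the coordinates sum `p` and difference `q`, the form `m² + n²` is `(p² + q²) / 2` and the
  -- strip restricts `p` alone. Parity is ignored: injectivity is enough for an upper bound.
  have hinj : Function.Injective (fun q : ℤ × ℤ => (q.1 + q.2, q.1 - q.2)) := by
    rintro ⟨a, b⟩ ⟨a', b'⟩ hab
    simp only [Prod.mk.injEq] at hab
    ext <;> simp only <;> omega
  calc _ ≤ ∑' q : ℤ × ℤ, h (q.1 + q.2, q.1 - q.2) := by
        refine ENNReal.tsum_le_tsum fun q => measure_mono fun x hx => ?_
        obtain ⟨h1, h2⟩ := hx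
        rw [abs_le] at h1
        refine ⟨⟨?_, ?_⟩, ?_⟩
        · push_cast; linarith
        · push_cast; linarith
        · push_cast
          rw [show 2 * x ^ 2 + (((q.1 : ℝ) + q.2) ^ 2 + ((q.1 : ℝ) - q.2) ^ 2) / 2 - T =
            2 * x ^ 2 + (q.1 : ℝ) ^ 2 + (q.2 : ℝ) ^ 2 - T by ring]
          exact h2
    _ ≤ ∑' r, h r := ENNReal.tsum_comp_le_tsum_of_injective hinj h
    _ = ∑' p : ℤ, ∑' q : ℤ, h (p, q) := ENNReal.tsum_prod'
    _ ≤ ∑' p : ℤ, 40 * {n : ℤ | (n : ℝ) ∈ Set.Icc (c - ℓ) (c + ℓ)}.indicator (1 : ℤ → ℝ≥0∞) p := by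
        refine ENNReal.tsum_le_tsum fun p => ?_
        by_cases hp : (p : ℝ) ∈ Set.Icc (c - ℓ) (c + ℓ)
        · rw [Set.indicator_of_mem (by exact hp), Pi.one_apply, mul_one]
          exact (ENNReal.tsum_le_tsum fun q => measure_mono fun x hx => hx.2).trans
            (tsum_volume_ellipse_slice_le p T)
        · refine (ENNReal.tsum_eq_zero.2 fun q => ?_).le.trans zero_le
          exact measure_mono_null (fun x hx => hp hx.1) measure_empty
    _ ≤ _ := by
        rw [ENNReal.tsum_mul_left, ← count_eq_tsum]
        gcongr
        refine (Int.count_Icc_le _ _).trans (le_of_eq ?_)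
        congr 2; ring

/-! ### The shell over an interval and a box -/

/-- The part over `J` of the slice at `q` of the shell `|2 x² + q₁² + q₂² - T| ≤ 1`, for `q` in the
box `[K - N, K + N]²`. -/
def shellSlice (K : ℤ) (N T : ℝ) (J : Set ℝ) (q : ℤ × ℤ) : Set ℝ :=
  {x | x ∈ J ∧ |(q.1 : ℝ) - K| ≤ N ∧ |(q.2 : ℝ) - K| ≤ N ∧
    |2 * x ^ 2 + (q.1 : ℝ) ^ 2 + (q.2 : ℝ) ^ 2 - T| ≤ 1}

theorem shellSlice_mono {K : ℤ} {N T : ℝ} {J J' : Set ℝ} (h : J ⊆ J') (q : ℤ × ℤ) :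
    shellSlice K N T J q ⊆ shellSlice K N T J' q := fun _ hx => ⟨h hx.1, hx.2⟩

theorem shellSlice_union (K : ℤ) (N T : ℝ) (J J' : Set ℝ) (q : ℤ × ℤ) :
    shellSlice K N T (J ∪ J') q = shellSlice K N T J q ∪ shellSlice K N T J' q := by
  ext x
  simp only [shellSlice, Set.mem_ofPred_eq, Set.mem_union]
  tauto

theorem measurableSet_shellSlice (K : ℤ) (N T : ℝ) {J : Set ℝ} (hJ : MeasurableSet J)
    (q : ℤ × ℤ) : MeasurableSet (shellSlice K N T J q) := by
  refine hJ.inter ((MeasurableSet.const _).inter ((MeasurableSet.const _).inter ?_))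
  exact measurableSet_le (f := fun x : ℝ => |2 * x ^ 2 + (q.1 : ℝ) ^ 2 + (q.2 : ℝ) ^ 2 - T|)
    (by fun_prop) measurable_const

theorem Real.volume_le_of_pairwise_abs_le {s : Set ℝ} {r : ℝ}
    (h : ∀ x ∈ s, ∀ y ∈ s, |x - y| ≤ r) : volume s ≤ ENNReal.ofReal r := by
  refine (Real.volume_le_diam s).trans (Metric.ediam_le fun x hx y hy => ?_)
  rw [edist_dist, Real.dist_eq]
  exact ENNReal.ofReal_le_ofReal (h x hx y hy)

/-- Two points `X`, `Y ≥ b` of a fibre satisfy `|X² - Y²| ≤ 1`, so the fibre has length at most `1 /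
(2b)`. The pairs with nonempty fibre lie in an annulus with `O(N + bs)` lattice points in the box,
and `N / b ≤ s` because `b ≥ s = √N`. The sign `σ` treats both half-lines at once. -/
theorem tsum_volume_shellSlice_le_of_far (K : ℤ) (T : ℝ) {N σ b s : ℝ} (hσ : σ ^ 2 = 1)
    (hs : 1 ≤ s) (hN : N = s ^ 2) (hb : s ≤ b) :
    ∑' q, volume (shellSlice K N T {x | σ * x ∈ Set.Icc b (b + s)} q) ≤
      ENNReal.ofReal (21 * s) := by
  have hb0 : 0 < b := by linarith
  set A := T - 1 - 2 * (b + s) ^ 2 with hA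
  -- `H = 2(b + s)² - 2b² + 2`, the range of `T - 2x²` widened by `1` on both sides.
  set H := 4 * b * s + 2 * s ^ 2 + 2 with hH
  set Q : Set (ℤ × ℤ) := {p : ℤ × ℤ | (p.1 : ℝ) ∈ Set.Icc (K - N) (K + N) ∧
    (p.2 : ℝ) ∈ Set.Icc (K - N) (K + N) ∧ (p.1 : ℝ) ^ 2 + (p.2 : ℝ) ^ 2 ∈ Set.Icc A (A + H)} with hQ
  have hx2 : ∀ x, σ * x ∈ Set.Icc b (b + s) → x ^ 2 = (σ * x) ^ 2 := fun x _ => by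
    rw [mul_pow, hσ, one_mul]
  have hterm : ∀ q, volume (shellSlice K N T {x | σ * x ∈ Set.Icc b (b + s)} q) ≤
      ENNReal.ofReal (1 / (2 * b)) * Q.indicator (1 : ℤ × ℤ → ℝ≥0∞) q := by
    intro q
    by_cases hq : q ∈ Q
    · rw [Set.indicator_of_mem hq, Pi.one_apply, mul_one]
      refine Real.volume_le_of_pairwise_abs_le fun x hx y hy => ?_
      have hx1 : σ * x ∈ Set.Icc b (b + s) := hx.1
      have hy1 : σ * y ∈ Set.Icc b (b + s) := hy.1
      have hx3 := abs_le.1 hx.2.2.2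
      have hy3 := abs_le.1 hy.2.2.2
      have e : |x - y| = |σ * x - σ * y| := by
        rw [← mul_sub, abs_mul]
        have : |σ| = 1 := by
          rw [← Real.sqrt_sq_eq_abs, hσ, Real.sqrt_one]
        rw [this, one_mul]
      rw [hx2 x hx1] at hx3
      rw [hx2 y hy1] at hy3
      rw [e]
      set X := σ * x
      set Y := σ * y
      rw [le_div_iff₀ (by positivity)]
      have hXY : |X - Y| * (X + Y) ≤ 1 := by
        have h0 : 0 ≤ X + Y := by linarith [hx1.1, hy1.1]
        rw [← abs_of_nonneg h0, ← abs_mul, abs_le]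
        constructor <;> nlinarith
      nlinarith [abs_nonneg (X - Y), hx1.1, hy1.1]
    · refine le_trans (le_of_eq ?_) zero_le
      refine measure_mono_null (t := ∅) (fun x hx => hq ?_) measure_empty
      have hx1 : σ * x ∈ Set.Icc b (b + s) := hx.1
      have h1 := abs_le.1 hx.2.1
      have h2 := abs_le.1 hx.2.2.1
      have h3 := abs_le.1 hx.2.2.2
      rw [hx2 x hx1] at h3
      refine ⟨⟨by linarith, by linarith⟩, ⟨by linarith, by linarith⟩, ?_, ?_⟩
      · nlinarith [hx1.1, hx1.2]
      · nlinarith [hx1.1, hx1.2]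
  refine (ENNReal.tsum_le_tsum hterm).trans ?_
  rw [ENNReal.tsum_mul_left, ← count_eq_tsum]
  have hN0 : 0 ≤ N := by rw [hN]; positivity
  refine (mul_le_mul_right (count_annulus_le (K - N) (K + N) A H (by linarith)
    (by positivity)) _).trans ?_
  rw [← ENNReal.ofReal_mul (by positivity)]
  apply ENNReal.ofReal_le_ofReal
  rw [one_div, inv_mul_le_iff₀ (by positivity)]
  have hpi : π * H ≤ 4 * H := by
    have : 0 ≤ H := by positivity
    nlinarith [Real.pi_le_four]
  have hH8 : H ≤ 8 * (b * s) := by rw [hH]; nlinarith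
  rw [hN]
  nlinarith

/-- Tile by at most `ℓ / s + 1` intervals of length `s`, starting at `max u s`, each contributing
`21 s`. -/
theorem tsum_volume_shellSlice_le_of_ge (K : ℤ) (T : ℝ) {N σ u ℓ s : ℝ} (hσ : σ ^ 2 = 1)
    (hs : 1 ≤ s) (hN : N = s ^ 2) (hℓ : 0 ≤ ℓ) :
    ∑' q, volume (shellSlice K N T {x | σ * x ∈ Set.Icc u (u + ℓ) ∧ s ≤ σ * x} q) ≤
      ENNReal.ofReal (21 * (ℓ + s)) := by
  have hs0 : 0 < s := by linarith
  set b : ℕ → ℝ := fun j => max u s + j * s with hb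
  set n := ⌊ℓ / s⌋₊ + 1 with hn
  have hsub : ∀ q, shellSlice K N T {x | σ * x ∈ Set.Icc u (u + ℓ) ∧ s ≤ σ * x} q ⊆
      ⋃ j ∈ Finset.range n, shellSlice K N T {x | σ * x ∈ Set.Icc (b j) (b j + s)} q := by
    intro q x hx
    obtain ⟨⟨hx1, hx2⟩, hx3⟩ := hx.1
    simp only [Set.mem_iUnion, Finset.mem_range]
    have hmax : max u s ≤ σ * x := max_le hx1 hx3
    have hd : 0 ≤ (σ * x - max u s) / s := div_nonneg (by linarith) hs0.le
    have h1 := Nat.floor_le hd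
    have h2 := Nat.lt_floor_add_one ((σ * x - max u s) / s)
    rw [le_div_iff₀ hs0] at h1
    rw [div_lt_iff₀ hs0] at h2
    refine ⟨⌊(σ * x - max u s) / s⌋₊, ?_, ⟨?_, ?_⟩, hx.2⟩
    · rw [hn, Nat.lt_succ_iff]
      refine Nat.floor_mono (div_le_div_of_nonneg_right ?_ hs0.le)
      linarith [le_max_left u s]
    · simp only [hb]; linarith
    · simp only [hb]; linarith
  calc _ ≤ ∑' q, ∑ j ∈ Finset.range n,
          volume (shellSlice K N T {x | σ * x ∈ Set.Icc (b j) (b j + s)} q) :=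
        ENNReal.tsum_le_tsum fun q => (measure_mono (hsub q)).trans (measure_biUnion_finset_le _ _)
    _ = ∑ j ∈ Finset.range n,
          ∑' q, volume (shellSlice K N T {x | σ * x ∈ Set.Icc (b j) (b j + s)} q) :=
        Summable.tsum_finsetSum fun _ _ => ENNReal.summable
    _ ≤ ∑ _j ∈ Finset.range n, ENNReal.ofReal (21 * s) :=
        Finset.sum_le_sum fun j _ => tsum_volume_shellSlice_le_of_far K T hσ hs hN (by
          simp only [hb]
          have : 0 ≤ (j : ℝ) * s := by positivity
          linarith [le_max_right u s])
    _ = ENNReal.ofReal (n * (21 * s)) := by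
        rw [Finset.sum_const, Finset.card_range, nsmul_eq_mul, ENNReal.ofReal_mul (p := (n : ℝ))
          (by positivity), ENNReal.ofReal_natCast]
    _ ≤ _ := by
        apply ENNReal.ofReal_le_ofReal
        have h := Nat.floor_le (div_nonneg hℓ hs0.le)
        rw [le_div_iff₀ hs0] at h
        rw [hn]; push_cast
        nlinarith

theorem count_circleBox_near_le {N B : ℝ} (K : ℤ) (V : ℝ)
    (hB : ∀ T : ℤ, ((circleBox K N T).ncard : ℝ) ≤ B) :
    Measure.count {q : ℤ × ℤ | |(q.1 : ℝ) - K| ≤ N ∧ |(q.2 : ℝ) - K| ≤ N ∧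
      |(q.1 : ℝ) ^ 2 + (q.2 : ℝ) ^ 2 - V| ≤ 1} ≤ ENNReal.ofReal (3 * B) := by
  have hB0 : 0 ≤ B := le_trans (by positivity) (hB 0)
  have hsub : {q : ℤ × ℤ | |(q.1 : ℝ) - K| ≤ N ∧ |(q.2 : ℝ) - K| ≤ N ∧
      |(q.1 : ℝ) ^ 2 + (q.2 : ℝ) ^ 2 - V| ≤ 1} ⊆
      -- A closed interval of length `2` contains at most three integers.
      ⋃ j ∈ Finset.range 3, circleBox K N (⌈V - 1⌉ + j) := by
    intro q hq
    obtain ⟨h1, h2, h3⟩ := hq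
    rw [abs_le] at h3
    have h4 : ⌈V - 1⌉ ≤ q.1 ^ 2 + q.2 ^ 2 := by
      rw [Int.ceil_le]; push_cast; linarith
    have h5 : q.1 ^ 2 + q.2 ^ 2 < ⌈V - 1⌉ + 3 := by
      have : ((q.1 ^ 2 + q.2 ^ 2 : ℤ) : ℝ) < ((⌈V - 1⌉ + 3 : ℤ) : ℝ) := by
        push_cast; linarith [Int.le_ceil (V - 1)]
      exact_mod_cast this
    simp only [Set.mem_iUnion, Finset.mem_range]
    exact ⟨(q.1 ^ 2 + q.2 ^ 2 - ⌈V - 1⌉).toNat, by omega, h1, h2, by omega⟩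
  refine (measure_mono hsub).trans ((measure_biUnion_finset_le _ _).trans ?_)
  have hterm : ∀ j ∈ Finset.range 3, Measure.count (circleBox K N (⌈V - 1⌉ + j)) ≤
      ENNReal.ofReal B := by
    intro j _
    have hf := finite_circleBox K N (⌈V - 1⌉ + j)
    rw [Measure.count_apply_finite' hf hf.measurableSet, ← Set.ncard_eq_toFinset_card _ hf,
      ← ENNReal.ofReal_natCast]
    exact ENNReal.ofReal_le_ofReal (hB _)
  refine (Finset.sum_le_sum hterm).trans (le_of_eq ?_)
  rw [Finset.sum_const, Finset.card_range, nsmul_eq_mul, ENNReal.ofReal_mul (by norm_num)]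
  simp

/-- Near `x = 0` the fibres in `x` can be long, so the order is reversed: for fixed `x` the lattice
points lie on at most three circles, and `x` ranges over length `2s`. -/
theorem tsum_volume_shellSlice_le_of_near {N B s : ℝ} (K : ℤ) (T : ℝ)
    (hB : ∀ T : ℤ, ((circleBox K N T).ncard : ℝ) ≤ B) :
    ∑' q, volume (shellSlice K N T (Set.Icc (-s) s) q) ≤ ENNReal.ofReal (6 * s * B) := by
  have hB0 : 0 ≤ B := le_trans (by positivity) (hB 0)
  set W : Set (ℝ × (ℤ × ℤ)) := {p | p.1 ∈ shellSlice K N T (Set.Icc (-s) s) p.2} with hW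
  have hsl : ∀ q, MeasurableSet {x | (x, q) ∈ W} := fun q =>
    measurableSet_shellSlice K N T measurableSet_Icc q
  have h1 := prod_count_apply (μ := (volume : Measure ℝ)) hsl
  rw [show (∑' q, volume (shellSlice K N T (Set.Icc (-s) s) q)) = ∑' q, volume {x | (x, q) ∈ W} from
    rfl, ← h1, Measure.prod_apply (measurableSet_prod_of_countable hsl)]
  calc ∫⁻ x, Measure.count (Prod.mk x ⁻¹' W)
      ≤ ∫⁻ x, (Set.Icc (-s) s).indicator (fun _ => ENNReal.ofReal (3 * B)) x := by
        refine lintegral_mono fun x => ?_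
        by_cases hx : x ∈ Set.Icc (-s) s
        · rw [Set.indicator_of_mem hx]
          refine le_trans (measure_mono fun q hq => ?_)
            (count_circleBox_near_le K (T - 2 * x ^ 2) hB)
          obtain ⟨-, h1, h2, h3⟩ := hq
          refine ⟨h1, h2, ?_⟩
          simp only at h3
          rw [show (q.1 : ℝ) ^ 2 + (q.2 : ℝ) ^ 2 - (T - 2 * x ^ 2) =
            2 * x ^ 2 + (q.1 : ℝ) ^ 2 + (q.2 : ℝ) ^ 2 - T by ring]
          exact h3
        · refine le_trans (le_of_eq ?_) zero_le
          exact measure_mono_null (t := ∅) (fun q hq => hx hq.1) measure_empty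
    _ = ENNReal.ofReal (3 * B) * ENNReal.ofReal (s - -s) := by
        rw [lintegral_indicator measurableSet_Icc, setLIntegral_const, Real.volume_Icc]
    _ = _ := by
        rw [← ENNReal.ofReal_mul (by positivity)]
        congr 1; ring

theorem tsum_volume_shellSlice_le {N B s u ℓ : ℝ} (K : ℤ) (T : ℝ)
    (hB : ∀ T : ℤ, ((circleBox K N T).ncard : ℝ) ≤ B) (hs : 1 ≤ s) (hN : N = s ^ 2) (hℓ : 0 ≤ ℓ) :
    ∑' q, volume (shellSlice K N T (Set.Icc u (u + ℓ)) q) ≤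
      ENNReal.ofReal (42 * (ℓ + s) + 6 * s * B) := by
  have hB0 : 0 ≤ B := le_trans (by positivity) (hB 0)
  have hsub : Set.Icc u (u + ℓ) ⊆ ({x | 1 * x ∈ Set.Icc u (u + ℓ) ∧ s ≤ 1 * x} ∪
      {x | -1 * x ∈ Set.Icc (-(u + ℓ)) (-(u + ℓ) + ℓ) ∧ s ≤ -1 * x}) ∪ Set.Icc (-s) s := by
    intro x hx
    rcases le_or_gt s x with h | h
    · exact Or.inl (Or.inl ⟨by rwa [one_mul], by rwa [one_mul]⟩)
    rcases le_or_gt s (-x) with h' | h'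
    · exact Or.inl (Or.inr ⟨⟨by linarith [hx.2], by linarith [hx.1]⟩, by linarith⟩)
    · exact Or.inr ⟨by linarith, h.le⟩
  have hle : ∀ q, volume (shellSlice K N T (Set.Icc u (u + ℓ)) q) ≤
      volume (shellSlice K N T {x | 1 * x ∈ Set.Icc u (u + ℓ) ∧ s ≤ 1 * x} q) +
      volume (shellSlice K N T
        {x | -1 * x ∈ Set.Icc (-(u + ℓ)) (-(u + ℓ) + ℓ) ∧ s ≤ -1 * x} q) +
      volume (shellSlice K N T (Set.Icc (-s) s) q) := fun q => by
    refine (measure_mono (shellSlice_mono hsub q)).trans ?_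
    rw [shellSlice_union, shellSlice_union]
    exact (measure_union_le _ _).trans (add_le_add (measure_union_le _ _) le_rfl)
  refine (ENNReal.tsum_le_tsum hle).trans ?_
  rw [ENNReal.tsum_add, ENNReal.tsum_add]
  refine (add_le_add (add_le_add
    (tsum_volume_shellSlice_le_of_ge K T (by norm_num) hs hN hℓ)
    (tsum_volume_shellSlice_le_of_ge K T (by norm_num) hs hN hℓ))
    (tsum_volume_shellSlice_le_of_near K T hB)).trans (le_of_eq ?_)
  rw [← ENNReal.ofReal_add (by positivity) (by positivity),
    ← ENNReal.ofReal_add (by positivity) (by positivity)]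
  congr 1; ring

/-! ### Counting resonances in the slab -/

namespace Waveguide

theorem norm_toPlane_sq (ξ : ℝ × ℤ) : ‖toPlane ξ‖ ^ 2 = ξ.1 ^ 2 + (ξ.2 : ℝ) ^ 2 := by
  rw [EuclideanSpace.norm_sq_eq, Fin.sum_univ_two]
  simp [toPlane]

theorem inner_toPlane (a : EuclideanSpace ℝ (Fin 2)) (ξ : ℝ × ℤ) :
    inner ℝ a (toPlane ξ) = a 0 * ξ.1 + a 1 * ξ.2 := by
  rw [PiLp.inner_apply, Fin.sum_univ_two]
  simp [toPlane, mul_comm]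

theorem norm_toPlane_sub_sq (ξ η : ℝ × ℤ) :
    ‖toPlane ξ - toPlane η‖ ^ 2 = (ξ.1 - η.1) ^ 2 + ((ξ.2 : ℝ) - η.2) ^ 2 := by
  rw [EuclideanSpace.norm_sq_eq, Fin.sum_univ_two]
  simp [toPlane]

theorem mem_slab_imp {a : EuclideanSpace ℝ (Fin 2)} {c : ℝ} {ξ₀ ξ : ℝ × ℤ} {M N : ℝ}
    (h : ξ ∈ slab a c ξ₀ M N) :
    |ξ.1 - ξ₀.1| ≤ N ∧ |(ξ.2 : ℝ) - ξ₀.2| ≤ N ∧ |a 0 * ξ.1 + a 1 * ξ.2 - c| ≤ M := by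
  obtain ⟨h1, h2⟩ := h
  rw [inner_toPlane] at h2
  have hN : 0 ≤ N := (norm_nonneg _).trans h1
  have h3 : ‖toPlane ξ - toPlane ξ₀‖ ^ 2 ≤ N ^ 2 := by gcongr
  rw [norm_toPlane_sub_sq] at h3
  exact ⟨abs_le_of_sq_le_sq (by nlinarith [sq_nonneg ((ξ.2 : ℝ) - ξ₀.2)]) hN,
    abs_le_of_sq_le_sq (by nlinarith [sq_nonneg (ξ.1 - ξ₀.1)]) hN, h2⟩

/-- The pairs of frequencies in the slab `(y, q.1)`, `(k - y, q.2)` with first components of sum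
`k` and almost prescribed total energy. -/
def resonantSlice (R : Set (ℝ × ℤ)) (k T : ℝ) (q : ℤ × ℤ) : Set ℝ :=
  {y | (y, q.1) ∈ R ∧ (k - y, q.2) ∈ R ∧
    |‖toPlane (y, q.1)‖ ^ 2 + ‖toPlane (k - y, q.2)‖ ^ 2 - T| ≤ 1}

/-- The threshold `θ = √(M/N)` for `|a 1|` balances the cases: dividing the slab width by `θ` gives
`M / θ = Nθ`, and tilting a strip of length `N` by `θ` gives `Nθ` as well. The remaining loss `√N ·
N^ε` comes from circles, with `ε = 1/2 - 4δ` positive exactly because `δ < 1/8`. -/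
theorem exists_tsum_volume_resonantSlice_le {δ : ℝ} (hδ₀ : 0 < δ) (hδ₁ : δ < 1 / 8) :
    ∃ C : ℝ, 0 < C ∧ ∀ (M N : ℝ), 1 ≤ M → M ≤ N →
      ∀ (a : EuclideanSpace ℝ (Fin 2)), ‖a‖ = 1 → ∀ (c : ℝ) (ξ₀ : ℝ × ℤ) (k T : ℝ),
        ∑' q, volume (resonantSlice (slab a c ξ₀ M N) k T q) ≤
          ENNReal.ofReal (C * (N * (M / N) ^ (4 * δ))) := by
  obtain ⟨C, hC, hcirc⟩ := exists_ncard_circleBox_le (ε := 1 / 2 - 4 * δ) (by linarith)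
  refine ⟨1000 + 6 * C, by positivity, fun M N hM hMN a ha c ξ₀ k T => ?_⟩
  have hN1 : 1 ≤ N := hM.trans hMN
  have hN0 : 0 < N := by linarith
  have hr0 : 0 < M / N := by positivity
  have hr1 : M / N ≤ 1 := (div_le_one hN0).2 hMN
  -- the parameters of the decomposition
  set θ := √(M / N) with hθ
  have hθ0 : 0 < θ := Real.sqrt_pos.2 hr0
  have hθ1 : θ ≤ 1 := Real.sqrt_le_one.2 hr1
  have hθ2 : θ ^ 2 * N = M := by rw [hθ, Real.sq_sqrt hr0.le]; field_simp
  set s := √N with hs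
  have hs1 : 1 ≤ s := Real.one_le_sqrt.2 hN1
  have hsN : N = s ^ 2 := (Real.sq_sqrt hN0.le).symm
  set D := N * (M / N) ^ (4 * δ) with hD
  -- `M/N ≤ 1` and `4δ ≤ 1/2`.
  have hD1 : N * θ ≤ D := by
    rw [hD, hθ, Real.sqrt_eq_rpow]
    exact mul_le_mul_of_nonneg_left (Real.rpow_le_rpow_of_exponent_ge hr0 hr1 (by linarith)) hN0.le
  -- The left side is `N (1/N)^{4δ}`, and `M ≥ 1`.
  have hD2 : s * N ^ (1 / 2 - 4 * δ) ≤ D := by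
    calc s * N ^ (1 / 2 - 4 * δ) = N * (1 / N) ^ (4 * δ) := by
          rw [hs, Real.sqrt_eq_rpow, ← Real.rpow_add hN0, one_div N, Real.inv_rpow hN0.le,
            ← Real.rpow_neg hN0.le]
          nth_rewrite 2 [← Real.rpow_one N]
          rw [← Real.rpow_add hN0]
          congr 1; ring
      _ ≤ D := by
          rw [hD]
          gcongr
  have hsD : s ≤ D := by
    refine le_trans ?_ hD2
    exact le_mul_of_one_le_right (by linarith) (Real.one_le_rpow hN1 (by linarith))
  have hθN : 0 < N * θ := by positivity
  have hD0 : 0 < D := by linarith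
  have hMθ : M = N * θ * θ := by rw [← hθ2]; ring
  have hMD : M ≤ N * θ := by rw [hMθ]; nlinarith
  have ha2 : a 0 ^ 2 + a 1 ^ 2 = 1 := by
    have := EuclideanSpace.norm_sq_eq a
    rw [ha, Fin.sum_univ_two] at this
    simpa using this.symm
  -- centre the slices
  have hshift : ∀ (q : ℤ × ℤ) (S : Set ℝ), resonantSlice (slab a c ξ₀ M N) k T q ⊆
      (fun y => y + -(k / 2)) ⁻¹' S → volume (resonantSlice (slab a c ξ₀ M N) k T q) ≤ volume S :=
    fun q S h => (measure_mono h).trans (measure_preimage_add_right _ _ _).le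
  set T' := T - k ^ 2 / 2 with hT'
  have henergy : ∀ (q : ℤ × ℤ) (y : ℝ), y ∈ resonantSlice (slab a c ξ₀ M N) k T q →
      |2 * (y + -(k / 2)) ^ 2 + (q.1 : ℝ) ^ 2 + (q.2 : ℝ) ^ 2 - T'| ≤ 1 := by
    intro q y hy
    have h := hy.2.2
    rw [norm_toPlane_sq, norm_toPlane_sq] at h
    simp only at h
    rw [show 2 * (y + -(k / 2)) ^ 2 + (q.1 : ℝ) ^ 2 + (q.2 : ℝ) ^ 2 - T' =
      y ^ 2 + (q.1 : ℝ) ^ 2 + ((k - y) ^ 2 + (q.2 : ℝ) ^ 2) - T by rw [hT']; ring]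
    exact h
  rcases le_or_gt (θ / 2) |a 1| with hcase | hcase
  · -- the slab is transversal to the lines `q.1 + q.2 = const`
    have ha1 : 0 < |a 1| := by linarith
    have ha1' : a 1 ≠ 0 := abs_pos.1 ha1
    set c' := (2 * c - a 0 * k) / a 1 with hc'
    have hle : ∑' q, volume (resonantSlice (slab a c ξ₀ M N) k T q) ≤
        40 * (ENNReal.ofReal (2 * (4 * (N * θ))) + 1) := by
      refine le_trans (ENNReal.tsum_le_tsum fun q => hshift q _ fun y hy => ?_)
        (tsum_volume_strip_le c' (4 * (N * θ)) T')
      refine ⟨?_, henergy q y hy⟩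
      have h1 := (mem_slab_imp hy.1).2.2
      have h2 := (mem_slab_imp hy.2.1).2.2
      simp only at h1 h2
      -- Adding the slab conditions of the two frequencies eliminates `y`, since their first
      -- components sum to `k`.
      have h3 : |a 1 * ((q.1 : ℝ) + q.2 - c')| ≤ 2 * M := by
        have e : a 1 * ((q.1 : ℝ) + q.2 - c') =
            (a 0 * y + a 1 * q.1 - c) + (a 0 * (k - y) + a 1 * q.2 - c) := by
          rw [hc']; field_simp; ring
        rw [e]
        exact (abs_add_le _ _).trans (by linarith)
      rw [abs_mul] at h3
      have h4 : θ / 2 * |(q.1 : ℝ) + q.2 - c'| ≤ 2 * M :=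
        (mul_le_mul_of_nonneg_right hcase (abs_nonneg _)).trans h3
      rw [hMθ] at h4
      have h5 : θ * |(q.1 : ℝ) + q.2 - c'| ≤ θ * (4 * (N * θ)) := by linarith
      exact le_of_mul_le_mul_left h5 hθ0
    refine hle.trans ?_
    rw [← ENNReal.ofReal_one, ← ENNReal.ofReal_add (by positivity) zero_le_one,
      show (40 : ℝ≥0∞) = ENNReal.ofReal 40 by simp, ← ENNReal.ofReal_mul (by norm_num)]
    apply ENNReal.ofReal_le_ofReal
    nlinarith
  · -- the slab is close to a strip of constant first component
    have ha0 : 1 / 2 ≤ |a 0| := by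
      have h1 : |a 1| ≤ 1 / 2 := by linarith
      have h2 : |a 1| ^ 2 ≤ (1 / 2) ^ 2 := by gcongr
      rw [sq_abs] at h2
      by_contra hlt
      have h3 : |a 0| ^ 2 ≤ (1 / 2) ^ 2 := by
        gcongr; exact (not_le.1 hlt).le
      rw [sq_abs] at h3
      linarith
    have ha0' : a 0 ≠ 0 := abs_pos.1 (by linarith)
    set y₀ := (c - a 1 * ξ₀.2) / a 0 with hy₀
    have hB : ∀ V : ℤ, ((circleBox ξ₀.2 N V).ncard : ℝ) ≤ C * N ^ (1 / 2 - 4 * δ) := fun V =>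
      hcirc _ _ _ hN1
    refine le_trans (ENNReal.tsum_le_tsum fun q => hshift q _ fun y hy => ?_)
      ((tsum_volume_shellSlice_le (u := y₀ - 4 * (N * θ) - k / 2) (ℓ := 8 * (N * θ))
        ξ₀.2 T' hB hs1 hsN (by positivity)).trans (ENNReal.ofReal_le_ofReal ?_))
    · have h1 := mem_slab_imp hy.1
      have h2 := mem_slab_imp hy.2.1
      simp only at h1 h2
      -- One slab condition suffices: the variation of `a 1 * q.1` over the box is at most `θ N /
      -- 2`, and `M ≤ N θ`.
      have h3 : |a 0 * (y - y₀)| ≤ 2 * (N * θ) := by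
        have e : a 0 * (y - y₀) = (a 0 * y + a 1 * q.1 - c) - a 1 * ((q.1 : ℝ) - ξ₀.2) := by
          rw [hy₀]; field_simp; ring
        rw [e]
        refine (abs_sub _ _).trans ?_
        rw [abs_mul]
        have : |a 1| * |(q.1 : ℝ) - ξ₀.2| ≤ θ / 2 * N :=
          mul_le_mul hcase.le h1.2.1 (abs_nonneg _) (by positivity)
        nlinarith [h1.2.2]
      rw [abs_mul] at h3
      have h4 : |y - y₀| ≤ 4 * (N * θ) := by nlinarith [abs_nonneg (y - y₀)]
      rw [abs_le] at h4
      exact ⟨⟨by linarith, by linarith⟩, h1.2.1, h2.2.1, henergy q y hy⟩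
    · have h6 : 6 * s * (C * N ^ (1 / 2 - 4 * δ)) = 6 * C * (s * N ^ (1 / 2 - 4 * δ)) := by ring
      rw [h6]
      have h7 : 6 * C * (s * N ^ (1 / 2 - 4 * δ)) ≤ 6 * C * D := by gcongr
      linarith

end Waveguide

/-! ### Squares of oscillatory integrals and Schur's test -/

open scoped ComplexConjugate in
/-- Expansion of the square of an oscillatory integral, averaged against a finite measure. -/
theorem lintegral_enorm_integral_sq_le {X Ω : Type*} [MeasurableSpace X] [MeasurableSpace Ω]
    (P : Measure X) [IsFiniteMeasure P] (ν : Measure Ω) [SFinite ν] {e : X → Ω → ℂ}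
    (he : Measurable (Function.uncurry e)) (he1 : ∀ p ω, ‖e p ω‖ ≤ 1) {G : Ω → ℂ}
    (hGm : Measurable G) (hG : Integrable G ν) :
    ∫⁻ p, ‖∫ ω, e p ω * G ω ∂ν‖ₑ ^ 2 ∂P ≤
      ∫⁻ ω, ∫⁻ ω', ‖G ω‖ₑ * ‖G ω'‖ₑ * ‖∫ p, e p ω * conj (e p ω') ∂P‖ₑ ∂ν ∂ν := by
  set V : X → ℂ := fun p => ∫ ω, e p ω * G ω ∂ν with hV
  set F : X → Ω × Ω → ℂ := fun p q => (e p q.1 * G q.1) * conj (e p q.2 * G q.2) with hF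
  have hFm : Measurable (Function.uncurry F) := by
    have h1 : Measurable fun r : X × (Ω × Ω) => e r.1 r.2.1 :=
      he.comp (measurable_fst.prodMk (measurable_fst.comp measurable_snd))
    have h2 : Measurable fun r : X × (Ω × Ω) => e r.1 r.2.2 :=
      he.comp (measurable_fst.prodMk (measurable_snd.comp measurable_snd))
    have h3 : Measurable fun r : X × (Ω × Ω) => G r.2.1 :=
      hGm.comp (measurable_fst.comp measurable_snd)
    have h4 : Measurable fun r : X × (Ω × Ω) => G r.2.2 :=
      hGm.comp (measurable_snd.comp measurable_snd)
    exact (h1.mul h3).mul (Complex.continuous_conj.measurable.comp (h2.mul h4))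
  have hFint : Integrable (Function.uncurry F) (P.prod (ν.prod ν)) := by
    have h : Integrable (fun r : X × (Ω × Ω) => (1 : ℂ) * (G r.2.1 * G r.2.2))
        (P.prod (ν.prod ν)) := (integrable_const (1 : ℂ)).mul_prod (hG.mul_prod hG)
    refine h.mono hFm.aestronglyMeasurable (Filter.Eventually.of_forall fun r => ?_)
    simp only [Function.uncurry, hF, norm_mul, RCLike.norm_conj, one_mul]
    calc ‖e r.1 r.2.1‖ * ‖G r.2.1‖ * (‖e r.1 r.2.2‖ * ‖G r.2.2‖)
        ≤ 1 * ‖G r.2.1‖ * (1 * ‖G r.2.2‖) := by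
          gcongr <;> exact he1 _ _
      _ = _ := by ring
  have hVV : ∀ p, ((‖V p‖ ^ 2 : ℝ) : ℂ) = ∫ q, F p q ∂(ν.prod ν) := by
    intro p
    rw [hF]
    simp only
    rw [integral_prod_mul (fun ω => e p ω * G ω) (fun ω => conj (e p ω * G ω)), integral_conj,
      Complex.mul_conj, Complex.normSq_eq_norm_sq]
  have hint : Integrable (fun p => ((‖V p‖ ^ 2 : ℝ) : ℂ)) P := by
    simp_rw [hVV]
    exact hFint.integral_prod_left
  have hint' : Integrable (fun p => ‖V p‖ ^ 2) P := by
    refine (Complex.reCLM.integrable_comp hint).congr (Filter.Eventually.of_forall fun p => ?_)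
    exact Complex.ofReal_re _
  calc ∫⁻ p, ‖V p‖ₑ ^ 2 ∂P = ∫⁻ p, ENNReal.ofReal (‖V p‖ ^ 2) ∂P := by
        refine lintegral_congr fun p => ?_
        rw [ENNReal.ofReal_pow (norm_nonneg _), ofReal_norm]
    _ = ENNReal.ofReal (∫ p, ‖V p‖ ^ 2 ∂P) :=
        (ofReal_integral_eq_lintegral_ofReal hint'
          (Filter.Eventually.of_forall fun p => by positivity)).symm
    _ = ‖∫ p, ((‖V p‖ ^ 2 : ℝ) : ℂ) ∂P‖ₑ := by
        rw [integral_complex_ofReal, ← ofReal_norm, Complex.norm_real, Real.norm_of_nonneg]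
        positivity
    _ = ‖∫ q, ∫ p, F p q ∂P ∂(ν.prod ν)‖ₑ := by
        simp_rw [hVV]
        rw [integral_integral_swap hFint]
    _ ≤ ∫⁻ q, ‖∫ p, F p q ∂P‖ₑ ∂(ν.prod ν) := enorm_integral_le_lintegral_enorm _
    _ = ∫⁻ q, ‖G q.1‖ₑ * ‖G q.2‖ₑ * ‖∫ p, e p q.1 * conj (e p q.2) ∂P‖ₑ ∂(ν.prod ν) := by
        refine lintegral_congr fun q => ?_
        have h : ∀ p, F p q = (G q.1 * conj (G q.2)) * (e p q.1 * conj (e p q.2)) := fun p => by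
          simp only [hF, map_mul]; ring
        simp_rw [h]
        rw [integral_const_mul, enorm_mul, enorm_mul, RCLike.enorm_conj]
    _ = _ := by
        rw [lintegral_prod]
        refine Measurable.aemeasurable ?_
        have hk : Measurable fun q : Ω × Ω => ∫ p, e p q.1 * conj (e p q.2) ∂P := by
          refine StronglyMeasurable.measurable (StronglyMeasurable.integral_prod_left
            (f := fun (p : X) (q : Ω × Ω) => e p q.1 * conj (e p q.2)) ?_)
          have h1 : Measurable fun r : X × (Ω × Ω) => e r.1 r.2.1 :=
            he.comp (measurable_fst.prodMk (measurable_fst.comp measurable_snd))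
          have h2 : Measurable fun r : X × (Ω × Ω) => e r.1 r.2.2 :=
            he.comp (measurable_fst.prodMk (measurable_snd.comp measurable_snd))
          exact (h1.mul (Complex.continuous_conj.measurable.comp h2)).stronglyMeasurable
        exact ((hGm.comp measurable_fst).enorm.mul (hGm.comp measurable_snd).enorm).mul hk.enorm

/-- Schur's test for a symmetric kernel. -/
theorem lintegral_lintegral_mul_mul_le_of_schur {Ω : Type*} [MeasurableSpace Ω] (ν : Measure Ω)
    [SFinite ν] {g : Ω → ℝ≥0∞} (hg : Measurable g) {K : Ω → Ω → ℝ≥0∞}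
    (hK : Measurable (Function.uncurry K)) (hsymm : ∀ ω ω', K ω ω' = K ω' ω) {A : ℝ≥0∞}
    (hA : ∀ ω, ∫⁻ ω', K ω ω' ∂ν ≤ A) :
    ∫⁻ ω, ∫⁻ ω', g ω * g ω' * K ω ω' ∂ν ∂ν ≤ 2 * A * ∫⁻ ω, g ω ^ 2 ∂ν := by
  -- This crude form without the factor `1/2` accounts for the `2` in the conclusion.
  have hpt : ∀ a b : ℝ≥0∞, a * b ≤ a ^ 2 + b ^ 2 := fun a b => by
    rcases le_total a b with h | h
    · calc a * b ≤ b * b := by gcongr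
        _ ≤ _ := by rw [← sq]; exact le_add_self
    · calc a * b ≤ a * a := by gcongr
        _ ≤ _ := by rw [← sq]; exact le_self_add
  have hmK : ∀ ω, Measurable (K ω) := fun ω => hK.comp measurable_prodMk_left
  have h1 : ∫⁻ ω, ∫⁻ ω', g ω ^ 2 * K ω ω' ∂ν ∂ν ≤ A * ∫⁻ ω, g ω ^ 2 ∂ν := by
    rw [← lintegral_const_mul _ (hg.pow_const 2)]
    refine lintegral_mono fun ω => ?_
    rw [lintegral_const_mul _ (hmK ω), mul_comm A]
    exact mul_le_mul_right (hA ω) _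
  have h2 : ∫⁻ ω, ∫⁻ ω', g ω' ^ 2 * K ω ω' ∂ν ∂ν = ∫⁻ ω, ∫⁻ ω', g ω ^ 2 * K ω ω' ∂ν ∂ν := by
    rw [lintegral_lintegral_swap]
    · refine lintegral_congr fun ω => lintegral_congr fun ω' => ?_
      rw [hsymm]
    · exact (((hg.comp measurable_snd).pow_const 2).mul hK).aemeasurable
  calc ∫⁻ ω, ∫⁻ ω', g ω * g ω' * K ω ω' ∂ν ∂ν
      ≤ ∫⁻ ω, ∫⁻ ω', (g ω ^ 2 * K ω ω' + g ω' ^ 2 * K ω ω') ∂ν ∂ν := by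
        refine lintegral_mono fun ω => lintegral_mono fun ω' => ?_
        rw [← add_mul]
        exact mul_le_mul_left (hpt _ _) _
    _ = ∫⁻ ω, ∫⁻ ω', g ω ^ 2 * K ω ω' ∂ν ∂ν + ∫⁻ ω, ∫⁻ ω', g ω' ^ 2 * K ω ω' ∂ν ∂ν := by
        rw [← lintegral_add_left]
        · refine lintegral_congr fun ω => ?_
          rw [lintegral_add_left ((hmK ω).const_mul _)]
        · exact Measurable.lintegral_prod_right'
            (f := fun q : Ω × Ω => g q.1 ^ 2 * K q.1 q.2)
            (((hg.comp measurable_fst).pow_const 2).mul hK)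
    _ ≤ A * ∫⁻ ω, g ω ^ 2 ∂ν + A * ∫⁻ ω, g ω ^ 2 ∂ν := by
        rw [h2]; exact add_le_add h1 h1
    _ = _ := by ring

/-! ### The Gaussian regularisation in space -/

/-- The weight with Fourier transform `e ^ (-b x ^ 2)`, up to normalisation. -/
noncomputable def gaussianWeight (b k : ℝ) : ℝ := √(π / b) * Real.exp (-(k ^ 2 / (4 * b)))

theorem gaussianWeight_nonneg (b k : ℝ) : 0 ≤ gaussianWeight b k := by
  unfold gaussianWeight; positivity

theorem measurable_gaussianWeight (b : ℝ) : Measurable (gaussianWeight b) := by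
  unfold gaussianWeight; fun_prop

theorem integral_gaussian_mul_cexp {b : ℝ} (hb : 0 < b) (k : ℝ) :
    ∫ x : ℝ, (Real.exp (-b * x ^ 2) : ℂ) * Complex.exp (Complex.I * ((x * k : ℝ) : ℂ)) =
      (gaussianWeight b k : ℂ) := by
  have h := fourierIntegral_gaussian (b := (b : ℂ)) (by simpa using hb) (k : ℂ)
  have e : ∀ x : ℝ, (Real.exp (-b * x ^ 2) : ℂ) * Complex.exp (Complex.I * ((x * k : ℝ) : ℂ)) =
      Complex.exp (Complex.I * k * x) * Complex.exp (-b * x ^ 2) := by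
    intro x
    push_cast
    rw [mul_comm]
    congr 2; ring
  simp_rw [e]
  rw [h, gaussianWeight]
  push_cast
  congr 1
  · rw [Real.sqrt_eq_rpow, Complex.ofReal_cpow (by positivity)]
    push_cast; rfl
  · congr 1; ring

/-- The mass is independent of `b`, which keeps the Schur bound uniform as `b → 0`. -/
theorem lintegral_gaussianWeight {b : ℝ} (hb : 0 < b) :
    ∫⁻ k, ENNReal.ofReal (gaussianWeight b k) = ENNReal.ofReal (2 * π) := by
  have hint : Integrable (gaussianWeight b) := by
    have := (integrable_exp_neg_mul_sq (b := 1 / (4 * b)) (by positivity)).const_mul (√(π / b))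
    refine this.congr (Filter.Eventually.of_forall fun k => ?_)
    simp only [gaussianWeight]
    congr 2; ring
  rw [← ofReal_integral_eq_lintegral_ofReal hint
    (Filter.Eventually.of_forall (gaussianWeight_nonneg b))]
  congr 1
  have e : ∀ k, gaussianWeight b k = √(π / b) * Real.exp (-(1 / (4 * b)) * k ^ 2) := fun k => by
    simp only [gaussianWeight]
    congr 2; ring
  simp_rw [e]
  rw [integral_const_mul, integral_gaussian, ← Real.sqrt_mul (by positivity)]
  rw [show π / b * (π / (1 / (4 * b))) = (2 * π) ^ 2 by field_simp; ring,
    Real.sqrt_sq (by positivity)]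

/-! ### The weighted fourth-power estimate -/

namespace Waveguide

instance : SigmaFinite freqMeasure := by unfold freqMeasure; infer_instance

theorem lintegral_freqMeasure {F : ℝ × ℤ → ℝ≥0∞} (hF : Measurable F) :
    ∫⁻ ξ, F ξ ∂freqMeasure = ∑' m, ∫⁻ x, F (x, m) := by
  rw [freqMeasure, lintegral_prod_symm _ hF.aemeasurable, lintegral_count]

/-- The total energy of a pair of frequencies. -/
noncomputable def pairEnergy (ω : (ℝ × ℤ) × (ℝ × ℤ)) : ℝ := ‖toPlane ω.1‖ ^ 2 + ‖toPlane ω.2‖ ^ 2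

/-- The first component of the total momentum of a pair of frequencies. -/
def pairMomentum (ω : (ℝ × ℤ) × (ℝ × ℤ)) : ℝ := ω.1.1 + ω.2.1

theorem measurable_norm_toPlane_sq : Measurable fun ξ : ℝ × ℤ => ‖toPlane ξ‖ ^ 2 := by
  simp_rw [norm_toPlane_sq]
  exact (measurable_fst.pow_const 2).add
    (((Measurable.of_discrete (f := fun n : ℤ => (n : ℝ))).comp measurable_snd).pow_const 2)

theorem measurable_pairEnergy : Measurable pairEnergy :=
  (measurable_norm_toPlane_sq.comp measurable_fst).add
    (measurable_norm_toPlane_sq.comp measurable_snd)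

theorem measurable_pairMomentum : Measurable pairMomentum :=
  (measurable_fst.comp measurable_fst).add (measurable_fst.comp measurable_snd)

/-- The plane wave `e^{i x ξ₁ - i t |ξ|²}` at `p = (t, x)`. -/
noncomputable def planeWave (p : ℝ × ℝ) (ξ : ℝ × ℤ) : ℂ :=
  Complex.exp (Complex.I * ((p.2 * ξ.1 - p.1 * ‖toPlane ξ‖ ^ 2 : ℝ) : ℂ))

theorem norm_planeWave (p : ℝ × ℝ) (ξ : ℝ × ℤ) : ‖planeWave p ξ‖ = 1 := by
  rw [planeWave, mul_comm, Complex.norm_exp_ofReal_mul_I]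

theorem measurable_planeWave : Measurable (Function.uncurry planeWave) := by
  have h : Measurable fun r : (ℝ × ℝ) × (ℝ × ℤ) => r.1.2 * r.2.1 - r.1.1 * ‖toPlane r.2‖ ^ 2 :=
    ((measurable_snd.comp measurable_fst).mul (measurable_fst.comp measurable_snd)).sub
      ((measurable_fst.comp measurable_fst).mul (measurable_norm_toPlane_sq.comp measurable_snd))
  exact Complex.measurable_exp.comp ((Complex.measurable_ofReal.comp h).const_mul Complex.I)

/-- The Schur kernel of the square of the evolution. -/
noncomputable def resonanceKernel (b B : ℝ) (ω ω' : (ℝ × ℤ) × (ℝ × ℤ)) : ℝ≥0∞ :=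
  {s : ℝ | |s| ≤ 1}.indicator (fun _ => ENNReal.ofReal B) (pairEnergy ω - pairEnergy ω') *
    ENNReal.ofReal (gaussianWeight b (pairMomentum ω - pairMomentum ω'))

theorem measurable_resonanceKernel (b B : ℝ) :
    Measurable (Function.uncurry (resonanceKernel b B)) := by
  have h1 : Measurable fun q : ((ℝ × ℤ) × (ℝ × ℤ)) × ((ℝ × ℤ) × (ℝ × ℤ)) =>
      pairEnergy q.1 - pairEnergy q.2 :=
    (measurable_pairEnergy.comp measurable_fst).sub (measurable_pairEnergy.comp measurable_snd)
  have h2 : Measurable fun q : ((ℝ × ℤ) × (ℝ × ℤ)) × ((ℝ × ℤ) × (ℝ × ℤ)) =>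
      pairMomentum q.1 - pairMomentum q.2 :=
    (measurable_pairMomentum.comp measurable_fst).sub (measurable_pairMomentum.comp measurable_snd)
  have h3 : MeasurableSet {s : ℝ | |s| ≤ 1} := measurableSet_le (by fun_prop) measurable_const
  exact ((measurable_const.indicator h3).comp h1).mul
    ((measurable_gaussianWeight b).comp h2).ennreal_ofReal

theorem resonanceKernel_symm (b B : ℝ) (ω ω' : (ℝ × ℤ) × (ℝ × ℤ)) :
    resonanceKernel b B ω ω' = resonanceKernel b B ω' ω := by
  unfold resonanceKernel
  congr 1
  · by_cases h : |pairEnergy ω - pairEnergy ω'| ≤ 1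
    · rw [Set.indicator_of_mem (by exact h),
        Set.indicator_of_mem (by rw [abs_sub_comm] at h; exact h)]
    · rw [Set.indicator_of_notMem (by exact h),
        Set.indicator_of_notMem (by rw [abs_sub_comm] at h; exact h)]
  · unfold gaussianWeight
    rw [← neg_sub, neg_sq]

theorem measurableSet_resonantSlice {R : Set (ℝ × ℤ)} (hR : MeasurableSet R) (T : ℝ)
    (q : ℤ × ℤ) : MeasurableSet {r : ℝ × ℝ | r.2 ∈ resonantSlice R r.1 T q} := by
  have h1 : Measurable fun r : ℝ × ℝ => ((r.2, q.1) : ℝ × ℤ) := by fun_prop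
  have h2 : Measurable fun r : ℝ × ℝ => ((r.1 - r.2, q.2) : ℝ × ℤ) := by fun_prop
  have h3 : Measurable fun r : ℝ × ℝ =>
      |‖toPlane (r.2, q.1)‖ ^ 2 + ‖toPlane (r.1 - r.2, q.2)‖ ^ 2 - T| :=
    (((measurable_norm_toPlane_sq.comp h1).add
      (measurable_norm_toPlane_sq.comp h2)).sub measurable_const).abs
  exact (h1 hR).inter ((h2 hR).inter (measurableSet_le h3 measurable_const))

/-- Replace the second real frequency by the total momentum `k` and integrate over `k` last. For
fixed `k` the energy window leaves exactly the resonant slices, of total measure at most `A`; the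
Gaussian in `k` then integrates to `2π`. -/
theorem lintegral_resonanceKernel_le {R : Set (ℝ × ℤ)} (hR : MeasurableSet R) {b B : ℝ}
    (hb : 0 < b) {A : ℝ≥0∞}
    (hA : ∀ k T, ∑' q, volume (resonantSlice R k T q) ≤ A) (ω : (ℝ × ℤ) × (ℝ × ℤ)) :
    ∫⁻ ω', resonanceKernel b B ω ω' ∂((freqMeasure.restrict R).prod (freqMeasure.restrict R)) ≤
      ENNReal.ofReal (2 * π) * ENNReal.ofReal B * A := by
  set H : (ℝ × ℤ) × (ℝ × ℤ) → ℝ≥0∞ := (R ×ˢ R).indicator (resonanceKernel b B ω) with hH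
  have hHm : Measurable H :=
    ((measurable_resonanceKernel b B).comp measurable_prodMk_left).indicator (hR.prod hR)
  have hm : ∀ m n : ℤ, Measurable fun r : ℝ × ℝ => H ((r.2, m), (r.1 - r.2, n)) := fun m n =>
    hHm.comp (by fun_prop)
  have hval : ∀ (m n : ℤ) (k x : ℝ), H ((x, m), (k - x, n)) =
      ENNReal.ofReal B * ENNReal.ofReal (gaussianWeight b (pairMomentum ω - k)) *
        (resonantSlice R k (pairEnergy ω) (m, n)).indicator 1 x := by
    intro m n k x
    have hmom : pairMomentum ((x, m), (k - x, n)) = k := by simp [pairMomentum]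
    by_cases h : x ∈ resonantSlice R k (pairEnergy ω) (m, n)
    · have hr : ((x, m), (k - x, n)) ∈ R ×ˢ R := ⟨h.1, h.2.1⟩
      have hs : pairEnergy ω - pairEnergy ((x, m), (k - x, n)) ∈ {s : ℝ | |s| ≤ 1} := by
        have := h.2.2
        rw [abs_sub_comm] at this
        exact this
      rw [Set.indicator_of_mem h, hH, Set.indicator_of_mem hr, resonanceKernel,
        Set.indicator_of_mem hs, hmom]
      simp
    · rw [Set.indicator_of_notMem h, mul_zero, hH]
      by_cases hr : ((x, m), (k - x, n)) ∈ R ×ˢ R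
      · rw [Set.indicator_of_mem hr, resonanceKernel, Set.indicator_of_notMem, zero_mul]
        intro hs
        refine h ⟨hr.1, hr.2, ?_⟩
        rw [abs_sub_comm]
        exact hs
      · exact Set.indicator_of_notMem hr _
  have hslice : ∀ (k : ℝ) (q : ℤ × ℤ), MeasurableSet (resonantSlice R k (pairEnergy ω) q) :=
    fun k q => measurable_prodMk_left (measurableSet_resonantSlice hR (pairEnergy ω) q)
  calc ∫⁻ ω', resonanceKernel b B ω ω' ∂((freqMeasure.restrict R).prod (freqMeasure.restrict R))
      = ∫⁻ ω', H ω' ∂(freqMeasure.prod freqMeasure) := by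
        rw [Measure.prod_restrict, ← lintegral_indicator (hR.prod hR)]
    _ = ∫⁻ ξ, ∫⁻ η, H (ξ, η) ∂freqMeasure ∂freqMeasure := lintegral_prod _ hHm.aemeasurable
    _ = ∑' m, ∫⁻ x, ∑' n, ∫⁻ y, H ((x, m), (y, n)) := by
        rw [lintegral_freqMeasure hHm.lintegral_prod_right']
        refine tsum_congr fun m => lintegral_congr fun x => ?_
        exact lintegral_freqMeasure (hHm.comp measurable_prodMk_left)
    _ = ∑' m, ∫⁻ x, ∑' n, ∫⁻ k, H ((x, m), (k - x, n)) := by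
        refine tsum_congr fun m => lintegral_congr fun x => tsum_congr fun n => ?_
        exact (lintegral_sub_right_eq_self (fun y => H ((x, m), (y, n))) x).symm
    _ = ∑' m, ∑' n, ∫⁻ x, ∫⁻ k, H ((x, m), (k - x, n)) := by
        refine tsum_congr fun m => lintegral_tsum fun n => ?_
        exact ((hm m n).comp measurable_swap).lintegral_prod_right'.aemeasurable
    _ = ∑' m, ∑' n, ∫⁻ k, ∫⁻ x, H ((x, m), (k - x, n)) := by
        refine tsum_congr fun m => tsum_congr fun n => ?_
        exact lintegral_lintegral_swap ((hm m n).comp measurable_swap).aemeasurable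
    _ = ∑' q : ℤ × ℤ, ∫⁻ k, ∫⁻ x, H ((x, q.1), (k - x, q.2)) := by rw [ENNReal.tsum_prod']
    _ = ∫⁻ k, ∑' q : ℤ × ℤ, ∫⁻ x, H ((x, q.1), (k - x, q.2)) := by
        rw [lintegral_tsum]
        exact fun q => (hm q.1 q.2).lintegral_prod_right'.aemeasurable
    _ ≤ ∫⁻ k, ENNReal.ofReal (gaussianWeight b (pairMomentum ω - k)) * (ENNReal.ofReal B * A) := by
        refine lintegral_mono fun k => ?_
        calc ∑' q : ℤ × ℤ, ∫⁻ x, H ((x, q.1), (k - x, q.2))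
            = ∑' q : ℤ × ℤ, ENNReal.ofReal B *
                ENNReal.ofReal (gaussianWeight b (pairMomentum ω - k)) *
                volume (resonantSlice R k (pairEnergy ω) q) := by
              refine tsum_congr fun q => ?_
              simp_rw [hval]
              rw [lintegral_const_mul _ (measurable_one.indicator (hslice k q)),
                lintegral_indicator_one (hslice k q)]
          _ ≤ ENNReal.ofReal B * ENNReal.ofReal (gaussianWeight b (pairMomentum ω - k)) * A := by
              rw [ENNReal.tsum_mul_left]
              gcongr
              exact hA _ _
          _ = _ := by ring
    _ = _ := by
        have hγ : Measurable fun k => ENNReal.ofReal (gaussianWeight b (pairMomentum ω - k)) :=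
          ((measurable_gaussianWeight b).comp (by fun_prop)).ennreal_ofReal
        rw [lintegral_mul_const _ hγ,
          lintegral_sub_left_eq_self (fun k => ENNReal.ofReal (gaussianWeight b k)),
          lintegral_gaussianWeight hb, mul_assoc]

theorem norm_fourierR_le {φ : ℝ → ℝ} (hφ : ∀ t, 0 ≤ φ t) (τ : ℝ) :
    ‖(2 * π : ℂ) * fourierR (fun t => (φ t : ℂ)) τ‖ ≤ ∫ t, φ t := by
  have hpi : (2 * π : ℂ) ≠ 0 := by exact_mod_cast Real.two_pi_pos.ne'
  rw [fourierR, ← mul_assoc, mul_one_div_cancel hpi, one_mul]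
  refine (norm_integral_le_integral_norm _).trans (le_of_eq (integral_congr_ae
    (Filter.Eventually.of_forall fun t => ?_)))
  simp only [norm_mul, Complex.norm_real, Real.norm_of_nonneg (hφ t)]
  rw [← mul_neg, mul_comm Complex.I, ← Complex.ofReal_neg, Complex.norm_exp_ofReal_mul_I, mul_one]

open scoped ComplexConjugate in
theorem planeWave_pair_mul_conj (p : ℝ × ℝ) (ω ω' : (ℝ × ℤ) × (ℝ × ℤ)) :
    planeWave p ω.1 * planeWave p ω.2 * conj (planeWave p ω'.1 * planeWave p ω'.2) =
      Complex.exp (-(Complex.I * (((pairEnergy ω - pairEnergy ω') * p.1 : ℝ) : ℂ))) *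
      Complex.exp (Complex.I * ((p.2 * (pairMomentum ω - pairMomentum ω') : ℝ) : ℂ)) := by
  simp only [planeWave, ← Complex.exp_add, ← Complex.exp_conj, map_add, map_mul, Complex.conj_I,
    Complex.conj_ofReal, pairEnergy, pairMomentum]
  congr 1
  push_cast
  ring

/-- The finite measure `φ(t) e^{-b x²} dt dx`. -/
noncomputable def cutoffMeasure (φ : ℝ → ℝ) (b : ℝ) : Measure (ℝ × ℝ) :=
  (volume : Measure (ℝ × ℝ)).withDensity
    fun p => ENNReal.ofReal (φ p.1 * Real.exp (-b * p.2 ^ 2))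

theorem isFiniteMeasure_cutoffMeasure {φ : ℝ → ℝ} (hint : Integrable φ) {b : ℝ} (hb : 0 < b) :
    IsFiniteMeasure (cutoffMeasure φ b) :=
  isFiniteMeasure_withDensity_ofReal (hint.mul_prod (integrable_exp_neg_mul_sq hb)).2

open scoped ComplexConjugate in
theorem integral_planeWave_cutoffMeasure {φ : ℝ → ℝ} (hφ : ∀ t, 0 ≤ φ t) (hφm : Measurable φ)
    {b : ℝ} (hb : 0 < b) (ω ω' : (ℝ × ℤ) × (ℝ × ℤ)) :
    ∫ p, planeWave p ω.1 * planeWave p ω.2 * conj (planeWave p ω'.1 * planeWave p ω'.2)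
        ∂(cutoffMeasure φ b) =
      ((2 * π : ℂ) * fourierR (fun t => (φ t : ℂ)) (pairEnergy ω - pairEnergy ω')) *
        (gaussianWeight b (pairMomentum ω - pairMomentum ω') : ℂ) := by
  have hpi : (2 * π : ℂ) ≠ 0 := by exact_mod_cast Real.two_pi_pos.ne'
  have hm : Measurable fun p : ℝ × ℝ => φ p.1 * Real.exp (-b * p.2 ^ 2) :=
    (hφm.comp measurable_fst).mul (by fun_prop)
  rw [cutoffMeasure, integral_withDensity_eq_integral_toReal_smul hm.ennreal_ofReal
    (Filter.Eventually.of_forall fun _ => ENNReal.ofReal_lt_top)]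
  rw [fourierR, ← mul_assoc, mul_one_div_cancel hpi, one_mul, ← integral_gaussian_mul_cexp hb,
    ← integral_prod_mul, ← Measure.volume_eq_prod]
  refine integral_congr_ae (Filter.Eventually.of_forall fun p => ?_)
  simp only
  rw [planeWave_pair_mul_conj, ENNReal.toReal_ofReal (mul_nonneg (hφ _) (Real.exp_pos _).le),
    Complex.real_smul, Complex.ofReal_mul]
  ring

/-- The fourth power is the square of an integral over pairs, with amplitude `g ⊗ g`. Its expansion
has a kernel dominated by `resonanceKernel`, whose rows are controlled by `A`, so Schur's test gives
the squared `L²` norm of `g ⊗ g`. -/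
theorem lintegral_cutoffMeasure_le {φ : ℝ → ℝ} (hφ : ∀ t, 0 ≤ φ t) (hφm : Measurable φ)
    (hint : Integrable φ) (hsupp : ∀ τ, 1 < |τ| → fourierR (fun t => (φ t : ℂ)) τ = 0)
    {R : Set (ℝ × ℤ)} (hR : MeasurableSet R) {g : ℝ × ℤ → ℂ} (hg : Measurable g)
    (hgi : IntegrableOn g R freqMeasure) {A : ℝ≥0∞}
    (hA : ∀ k T, ∑' q, volume (resonantSlice R k T q) ≤ A) {b : ℝ} (hb : 0 < b) :
    ∫⁻ p, ‖∫ ξ in R, planeWave p ξ * g ξ ∂freqMeasure‖ₑ ^ 4 ∂(cutoffMeasure φ b) ≤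
      2 * (ENNReal.ofReal (2 * π) * ENNReal.ofReal (∫ t, φ t) * A) *
        (∫⁻ ξ in R, ‖g ξ‖ₑ ^ 2 ∂freqMeasure) ^ 2 := by
  have := isFiniteMeasure_cutoffMeasure hint hb
  set μ := freqMeasure.restrict R with hμ
  set e : ℝ × ℝ → (ℝ × ℤ) × (ℝ × ℤ) → ℂ := fun p ω => planeWave p ω.1 * planeWave p ω.2 with he
  set G : (ℝ × ℤ) × (ℝ × ℤ) → ℂ := fun ω => g ω.1 * g ω.2 with hG
  have hGm : Measurable G := (hg.comp measurable_fst).mul (hg.comp measurable_snd)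
  have hem : Measurable (Function.uncurry e) :=
    (measurable_planeWave.comp (measurable_fst.prodMk (measurable_fst.comp measurable_snd))).mul
      (measurable_planeWave.comp (measurable_fst.prodMk (measurable_snd.comp measurable_snd)))
  have hsq : ∀ p, ‖∫ ξ, planeWave p ξ * g ξ ∂μ‖ₑ ^ 4 = ‖∫ ω, e p ω * G ω ∂(μ.prod μ)‖ₑ ^ 2 := by
    intro p
    have h : ∀ ω, e p ω * G ω = (planeWave p ω.1 * g ω.1) * (planeWave p ω.2 * g ω.2) := fun ω => by
      simp only [he, hG]; ring
    simp_rw [h]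
    rw [integral_prod_mul (fun ξ => planeWave p ξ * g ξ) (fun ξ => planeWave p ξ * g ξ), enorm_mul]
    ring
  simp_rw [hsq]
  refine (lintegral_enorm_integral_sq_le (cutoffMeasure φ b) (μ.prod μ) hem (fun p ω => ?_) hGm
    (hgi.mul_prod hgi)).trans ?_
  · simp only [he, norm_mul, norm_planeWave, mul_one, le_refl]
  have hker : ∀ ω ω', ‖∫ p, e p ω * (starRingEnd ℂ) (e p ω') ∂(cutoffMeasure φ b)‖ₑ ≤
      resonanceKernel b (∫ t, φ t) ω ω' := by
    intro ω ω'
    rw [he]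
    simp only
    rw [integral_planeWave_cutoffMeasure hφ hφm hb, enorm_mul, resonanceKernel]
    have h2 : ‖((gaussianWeight b (pairMomentum ω - pairMomentum ω') : ℝ) : ℂ)‖ₑ =
        ENNReal.ofReal (gaussianWeight b (pairMomentum ω - pairMomentum ω')) := by
      rw [← ofReal_norm, Complex.norm_real, Real.norm_of_nonneg (gaussianWeight_nonneg _ _)]
    rw [h2]
    gcongr
    by_cases h : |pairEnergy ω - pairEnergy ω'| ≤ 1
    · rw [Set.indicator_of_mem (by exact h), ← ofReal_norm]
      exact ENNReal.ofReal_le_ofReal (norm_fourierR_le hφ _)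
    · rw [hsupp _ (not_le.1 h)]
      simp
  have hG2 : ∫⁻ ω, ‖G ω‖ₑ ^ 2 ∂(μ.prod μ) = (∫⁻ ξ, ‖g ξ‖ₑ ^ 2 ∂μ) ^ 2 := by
    have hm := (hg.enorm.pow_const 2).aemeasurable (μ := μ)
    rw [sq, ← lintegral_prod_mul hm hm]
    refine lintegral_congr fun ω => ?_
    rw [hG, enorm_mul, mul_pow]
  rw [← hG2]
  refine le_trans (lintegral_mono fun ω => lintegral_mono fun ω' => mul_le_mul_right (hker ω ω') _)
    (lintegral_lintegral_mul_mul_le_of_schur (μ.prod μ) hGm.enorm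
      (measurable_resonanceKernel b _) (resonanceKernel_symm b _)
      fun ω => lintegral_resonanceKernel_le hR hb hA ω)

/-- The weighted `L⁴` bound for the evolution by the number of resonances. -/
theorem lintegral_cutoff_mul_le {φ : ℝ → ℝ} (hφ : ∀ t, 0 ≤ φ t) (hφm : Measurable φ)
    (hint : Integrable φ) (hsupp : ∀ τ, 1 < |τ| → fourierR (fun t => (φ t : ℂ)) τ = 0)
    {R : Set (ℝ × ℤ)} (hR : MeasurableSet R) {g : ℝ × ℤ → ℂ} (hg : Measurable g)
    (hgi : IntegrableOn g R freqMeasure) {A : ℝ≥0∞}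
    (hA : ∀ k T, ∑' q, volume (resonantSlice R k T q) ≤ A) :
    ∫⁻ p : ℝ × ℝ, ENNReal.ofReal (φ p.1) * ‖∫ ξ in R, planeWave p ξ * g ξ ∂freqMeasure‖ₑ ^ 4 ≤
      2 * (ENNReal.ofReal (2 * π) * ENNReal.ofReal (∫ t, φ t) * A) *
        (∫⁻ ξ in R, ‖g ξ‖ₑ ^ 2 ∂freqMeasure) ^ 2 := by
  set u : ℝ × ℝ → ℂ := fun p => ∫ ξ in R, planeWave p ξ * g ξ ∂freqMeasure with hu
  have hum : Measurable u := by
    refine StronglyMeasurable.measurable (StronglyMeasurable.integral_prod_right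
      (f := fun (p : ℝ × ℝ) (ξ : ℝ × ℤ) => planeWave p ξ * g ξ) ?_)
    exact (measurable_planeWave.mul (hg.comp measurable_snd)).stronglyMeasurable
  -- Fatou's lemma along `b = 1 / (n + 1)`; the bound for each `n` does not involve `b`.
  set w : ℕ → ℝ × ℝ → ℝ≥0∞ := fun n p =>
    ENNReal.ofReal (φ p.1 * Real.exp (-(1 / ((n : ℝ) + 1)) * p.2 ^ 2)) * ‖u p‖ₑ ^ 4 with hw
  have hdm : ∀ n : ℕ, Measurable fun p : ℝ × ℝ =>
      ENNReal.ofReal (φ p.1 * Real.exp (-(1 / ((n : ℝ) + 1)) * p.2 ^ 2)) := fun n =>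
    ((hφm.comp measurable_fst).mul (by fun_prop)).ennreal_ofReal
  have hlim : ∀ p, Filter.Tendsto (fun n => w n p) Filter.atTop
      (nhds (ENNReal.ofReal (φ p.1) * ‖u p‖ₑ ^ 4)) := by
    intro p
    refine ENNReal.Tendsto.mul_const ?_ (Or.inr (ENNReal.pow_ne_top enorm_ne_top))
    refine (ENNReal.continuous_ofReal.tendsto _).comp ?_
    have h1 := tendsto_one_div_add_atTop_nhds_zero_nat (𝕜 := ℝ)
    have h2 := ((Real.continuous_exp.tendsto _).comp (h1.neg.mul_const (p.2 ^ 2))).const_mul (φ p.1)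
    simpa using h2
  calc ∫⁻ p : ℝ × ℝ, ENNReal.ofReal (φ p.1) * ‖u p‖ₑ ^ 4
      = ∫⁻ p, Filter.liminf (fun n => w n p) Filter.atTop :=
        lintegral_congr fun p => (hlim p).liminf_eq.symm
    _ ≤ Filter.liminf (fun n => ∫⁻ p, w n p) Filter.atTop :=
        lintegral_liminf_le fun n => (hdm n).mul (hum.enorm.pow_const 4)
    _ ≤ _ := by
        refine Filter.liminf_le_of_frequently_le' (Filter.Frequently.of_forall fun n => ?_)
        have h := lintegral_cutoffMeasure_le hφ hφm hint hsupp hR hg hgi hA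
          (b := 1 / ((n : ℝ) + 1)) (by positivity)
        rw [cutoffMeasure, lintegral_withDensity_eq_lintegral_mul _ (hdm n)
          (hum.enorm.pow_const 4)] at h
        exact h

end Waveguide

/-! ### Plancherel inequality and integrability on the slab -/

namespace Waveguide

theorem measurable_fourierRT (f : L2RT) : Measurable (fourierRT f) := by
  refine measurable_from_prod_countable_left fun k => ?_
  have h := (Lp.stronglyMeasurable (𝓕 (partialCoeffLp f k))).measurable
  exact (h.comp (measurable_id.div_const (2 * π))).const_mul (1 / (2 * π) : ℂ)

theorem Lp_enorm_sq_eq_lintegral {α : Type*} [MeasurableSpace α] {μ : Measure α}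
    (h : Lp ℂ 2 μ) : ‖h‖ₑ ^ 2 = ∫⁻ x, ‖h x‖ₑ ^ 2 ∂μ := by
  have := eLpNorm_nnreal_pow_eq_lintegral (f := h) (μ := μ) (p := 2) two_ne_zero
  rw [Lp.enorm_def]
  simpa using this

theorem lintegral_comp_div_two_pi {h : ℝ → ℝ≥0∞} (hh : Measurable h) :
    ∫⁻ x, h (x / (2 * π)) = ENNReal.ofReal (2 * π) * ∫⁻ x, h x := by
  have hpi : (2 * π : ℝ) ≠ 0 := Real.two_pi_pos.ne'
  have hmap := Real.map_volume_mul_right (a := (2 * π)⁻¹) (inv_ne_zero hpi)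
  have h1 : ∫⁻ x, h x ∂(Measure.map (· * (2 * π)⁻¹) volume) = ∫⁻ x, h (x * (2 * π)⁻¹) :=
    lintegral_map hh (by fun_prop)
  rw [hmap, lintegral_smul_measure, inv_inv, abs_of_pos Real.two_pi_pos] at h1
  simp_rw [div_eq_mul_inv]
  rw [← h1, smul_eq_mul]

/-- Parseval's identity when `g` is square integrable. Admitting an infinite right side avoids
selecting almost every fibre later. -/
theorem tsum_enorm_sq_fourierCoeff_le {g : Torus → ℂ} (hg : StronglyMeasurable g) :
    ∑' k, ‖fourierCoeff g k‖ₑ ^ 2 ≤ ∫⁻ y, ‖g y‖ₑ ^ 2 ∂AddCircle.haarAddCircle := by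
  rcases eq_or_ne (∫⁻ y, ‖g y‖ₑ ^ 2 ∂AddCircle.haarAddCircle) ∞ with h | h
  · rw [h]; exact le_top
  have hmem : MemLp g 2 AddCircle.haarAddCircle := by
    refine ⟨hg.aestronglyMeasurable, ?_⟩
    rw [eLpNorm_lt_top_iff_lintegral_rpow_enorm_lt_top (by simp) (by simp)]
    simpa using h.lt_top
  have hs := hasSum_sq_fourierCoeff hmem.toLp
  rw [fourierCoeff_congr_ae hmem.coeFn_toLp] at hs
  have h1 : ∑' k, ‖fourierCoeff g k‖ₑ ^ 2 = ENNReal.ofReal (∑' k, ‖fourierCoeff g k‖ ^ 2) := by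
    rw [ENNReal.ofReal_tsum_of_nonneg (fun k => by positivity) hs.summable]
    refine tsum_congr fun k => ?_
    rw [ENNReal.ofReal_pow (norm_nonneg _), ofReal_norm]
  rw [h1, hs.tsum_eq, ofReal_integral_eq_lintegral_ofReal]
  · refine le_of_eq (lintegral_congr_ae ?_)
    filter_upwards [hmem.coeFn_toLp] with y hy
    rw [hy, ENNReal.ofReal_pow (norm_nonneg _), ofReal_norm]
  · exact (memLp_two_iff_integrable_sq_norm (Lp.aestronglyMeasurable _)).1 (Lp.memLp _)
  · exact Filter.Eventually.of_forall fun y => by positivity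

theorem tsum_enorm_sq_partialCoeffLp_le (f : L2RT) :
    ∑' k, ‖partialCoeffLp f k‖ₑ ^ 2 ≤ ‖f‖ₑ ^ 2 := by
  have hf : StronglyMeasurable f := Lp.stronglyMeasurable f
  have hfs : ∀ x, StronglyMeasurable fun y : Torus => f (x, y) := fun x =>
    hf.comp_measurable measurable_prodMk_left
  have hcm : ∀ k, AEMeasurable (fun x => ‖partialCoeff f k x‖ₑ ^ 2) volume := fun k =>
    (memLp_partialCoeff (Lp.memLp f) k).1.enorm.pow_const 2
  have hhaar : (AddCircle.haarAddCircle : Measure Torus) ≤ volume := by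
    rw [AddCircle.volume_eq_smul_haarAddCircle]
    refine Measure.le_iff.2 fun s _ => ?_
    rw [Measure.smul_apply, smul_eq_mul]
    refine le_mul_of_one_le_left zero_le ?_
    rw [ENNReal.one_le_ofReal]
    linarith [Real.pi_gt_three]
  calc ∑' k, ‖partialCoeffLp f k‖ₑ ^ 2 = ∑' k, ∫⁻ x, ‖partialCoeff f k x‖ₑ ^ 2 := by
        refine tsum_congr fun k => ?_
        rw [Lp_enorm_sq_eq_lintegral]
        refine lintegral_congr_ae ?_
        filter_upwards [(memLp_partialCoeff (Lp.memLp f) k).coeFn_toLp] with x hx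
        rw [partialCoeffLp, hx]
    _ = ∫⁻ x, ∑' k, ‖partialCoeff f k x‖ₑ ^ 2 := (lintegral_tsum hcm).symm
    _ ≤ ∫⁻ x, ∫⁻ y, ‖f (x, y)‖ₑ ^ 2 ∂AddCircle.haarAddCircle :=
        lintegral_mono fun x => tsum_enorm_sq_fourierCoeff_le (hfs x)
    _ ≤ ∫⁻ x, ∫⁻ y, ‖f (x, y)‖ₑ ^ 2 :=
        lintegral_mono fun x => lintegral_mono' hhaar le_rfl
    _ = ‖f‖ₑ ^ 2 := by
        rw [Lp_enorm_sq_eq_lintegral]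
        exact (lintegral_prod (fun p => ‖f p‖ₑ ^ 2)
          (hf.measurable.enorm.pow_const 2).aemeasurable).symm

/-- Plancherel in each variable; the normalising constants are at most `1` and are dropped. -/
theorem lintegral_enorm_sq_fourierRT_le (f : L2RT) :
    ∫⁻ ξ, ‖fourierRT f ξ‖ₑ ^ 2 ∂freqMeasure ≤ ‖f‖ₑ ^ 2 := by
  refine le_trans ?_ (tsum_enorm_sq_partialCoeffLp_le f)
  rw [lintegral_freqMeasure ((measurable_fourierRT f).enorm.pow_const 2)]
  refine ENNReal.tsum_le_tsum fun k => ?_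
  have hm : Measurable fun x => ‖(𝓕 (partialCoeffLp f k)) x‖ₑ ^ 2 :=
    (Lp.stronglyMeasurable _).measurable.enorm.pow_const 2
  have hF : ‖𝓕 (partialCoeffLp f k)‖ₑ = ‖partialCoeffLp f k‖ₑ := by
    rw [← ofReal_norm, Lp.norm_fourier_eq, ofReal_norm]
  have hpi : ‖(1 / (2 * π) : ℂ)‖ₑ = ENNReal.ofReal (1 / (2 * π)) := by
    rw [← ofReal_norm]
    congr 1
    rw [norm_div, norm_one, norm_mul, Complex.norm_two, Complex.norm_real,
      Real.norm_of_nonneg Real.pi_pos.le]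
  calc ∫⁻ x, ‖fourierRT f (x, k)‖ₑ ^ 2
      = ENNReal.ofReal (1 / (2 * π)) ^ 2 *
          ∫⁻ x : ℝ, ‖(𝓕 (partialCoeffLp f k)) (x / (2 * π))‖ₑ ^ 2 := by
        have hm' : Measurable fun x => ‖(𝓕 (partialCoeffLp f k)) (x / (2 * π))‖ₑ ^ 2 :=
          hm.comp (measurable_id.div_const (2 * π))
        rw [← lintegral_const_mul _ hm']
        refine lintegral_congr fun x => ?_
        rw [fourierRT, enorm_mul, mul_pow, hpi]
    _ = ENNReal.ofReal (1 / (2 * π)) ^ 2 * ENNReal.ofReal (2 * π) * ‖partialCoeffLp f k‖ₑ ^ 2 := by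
        rw [lintegral_comp_div_two_pi hm, ← Lp_enorm_sq_eq_lintegral, hF, mul_assoc]
    _ ≤ _ := by
        refine mul_le_of_le_one_left zero_le ?_
        rw [← ENNReal.ofReal_pow (by positivity), ← ENNReal.ofReal_mul (by positivity),
          ENNReal.ofReal_le_one]
        have : (1 / (2 * π)) ^ 2 * (2 * π) = 1 / (2 * π) := by field_simp
        rw [this, div_le_one (by positivity)]
        linarith [Real.pi_gt_three]

theorem continuous_toPlane : Continuous toPlane := by
  have h : Continuous fun ξ : ℝ × ℤ => (![ξ.1, (ξ.2 : ℝ)] : Fin 2 → ℝ) := by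
    refine continuous_pi fun i => ?_
    fin_cases i
    · exact continuous_fst
    · exact (continuous_of_discreteTopology (f := fun n : ℤ => (n : ℝ))).comp continuous_snd
  exact (PiLp.continuous_toLp 2 fun _ : Fin 2 => ℝ).comp h

theorem measurableSet_slab (a : EuclideanSpace ℝ (Fin 2)) (c : ℝ) (ξ₀ : ℝ × ℤ) (M N : ℝ) :
    MeasurableSet (slab a c ξ₀ M N) := by
  have h1 : IsClosed {ξ : ℝ × ℤ | ‖toPlane ξ - toPlane ξ₀‖ ≤ N} :=
    isClosed_le (continuous_toPlane.sub continuous_const).norm continuous_const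
  have h2 : IsClosed {ξ : ℝ × ℤ | |inner ℝ a (toPlane ξ) - c| ≤ M} :=
    isClosed_le ((continuous_const.inner continuous_toPlane).sub continuous_const).abs
      continuous_const
  exact (h1.inter h2).measurableSet

theorem freqMeasure_slab_lt_top (a : EuclideanSpace ℝ (Fin 2)) (c : ℝ) (ξ₀ : ℝ × ℤ) (M N : ℝ) :
    freqMeasure (slab a c ξ₀ M N) < ∞ := by
  have hsub : slab a c ξ₀ M N ⊆ Set.Icc (ξ₀.1 - N) (ξ₀.1 + N) ×ˢ
      {n : ℤ | (n : ℝ) ∈ Set.Icc (ξ₀.2 - N) (ξ₀.2 + N)} := by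
    intro ξ hξ
    obtain ⟨h1, h2, -⟩ := mem_slab_imp hξ
    rw [abs_le] at h1 h2
    exact ⟨⟨by linarith, by linarith⟩, by linarith, by linarith⟩
  refine (measure_mono hsub).trans_lt ?_
  rw [freqMeasure, Measure.prod_prod, Real.volume_Icc]
  exact ENNReal.mul_lt_top ENNReal.ofReal_lt_top
    ((Int.count_Icc_le _ _).trans_lt (ENNReal.add_lt_top.2 ⟨ENNReal.ofReal_lt_top, by simp⟩))

/-- On a set of finite measure, square integrable functions are integrable. -/
theorem integrable_fourierRT {f : L2RT} {S : Set (ℝ × ℤ)} (hS : MeasurableSet S)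
    (hfin : freqMeasure S < ∞) (hf : FourierSupportIn f S) :
    Integrable (fourierRT f) freqMeasure := by
  have hmem : MemLp (fourierRT f) 2 freqMeasure := by
    refine ⟨(measurable_fourierRT f).aestronglyMeasurable, ?_⟩
    rw [eLpNorm_lt_top_iff_lintegral_rpow_enorm_lt_top (by simp) (by simp)]
    have := (lintegral_enorm_sq_fourierRT_le f).trans_lt (ENNReal.pow_lt_top enorm_lt_top)
    simpa using this
  have : IsFiniteMeasure (freqMeasure.restrict S) := ⟨by simpa using hfin⟩
  have hon : IntegrableOn (fourierRT f) S freqMeasure :=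
    (hmem.restrict S).integrable (by norm_num)
  refine (integrable_indicator_iff hS |>.2 hon).congr ?_
  filter_upwards [hf] with ξ hξ
  by_cases h : ξ ∈ S
  · rw [Set.indicator_of_mem h]
  · rw [Set.indicator_of_notMem h, hξ h]

theorem evolution_eq_setIntegral {f : L2RT} {S : Set (ℝ × ℤ)} (hf : FourierSupportIn f S)
    (p : ℝ × ℝ) :
    evolution f p.1 p.2 = ∫ ξ in S, planeWave p ξ * fourierRT f ξ ∂freqMeasure := by
  refine (setIntegral_eq_integral_of_ae_compl_eq_zero ?_).symm
  filter_upwards [hf] with ξ hξ h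
  rw [hξ h, mul_zero]

theorem IsTimeCutoff.fourierR_eq_zero {φ : 𝓢(ℝ, ℝ)} (hφ : IsTimeCutoff φ) {τ : ℝ}
    (hτ : 1 < |τ|) : fourierR (fun t => (φ t : ℂ)) τ = 0 :=
  image_eq_zero_of_notMem_tsupport fun h => not_le.2 hτ (abs_le.2 (hφ.fourier_support h))

end Waveguide

/-! ### The Strichartz estimate -/

theorem theorem1p2 (φ : 𝓢(ℝ, ℝ)) (hφ : IsTimeCutoff φ) (δ : ℝ) (hδ₀ : 0 < δ) (hδ₁ : δ < 1 / 8) :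
    ∃ C : ℝ, 0 < C ∧
      ∀ (M N : ℝ), 1 ≤ M → M ≤ N →
      ∀ (a : EuclideanSpace ℝ (Fin 2)), ‖a‖ = 1 →
      ∀ (c : ℝ) (ξ₀ : ℝ × ℤ) (f : L2RT),
        FourierSupportIn f (slab a c ξ₀ M N) →
          Integrable (fourierRT f) freqMeasure ∧
          eLpNorm (fun p : ℝ × ℝ => (φ p.1 : ℂ) * evolution f p.1 p.2) 4 volume ≤
            ENNReal.ofReal (C * (M / N) ^ δ * N ^ (1 / 4 : ℝ) * ‖f‖) := by
  obtain ⟨C₀, hC₀, hcount⟩ := exists_tsum_volume_resonantSlice_le hδ₀ hδ₁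
  set B := ‖φ.toBoundedContinuousFunction‖ with hB
  have hφB : ∀ t, φ t ≤ B := fun t =>
    (Real.le_norm_self _).trans (φ.toBoundedContinuousFunction.norm_coe_le_norm t)
  have hB0 : 0 ≤ B := norm_nonneg _
  set I := ∫ t, φ t with hI
  have hI0 : 0 ≤ I := integral_nonneg hφ.nonneg
  -- `B ^ 3` comes from `φ ^ 4 ≤ B ^ 3 * φ`, the leading `2` from Schur's test, and `2 * π * I * C₀`
  -- from the row bound; the `+ 1` only ensures positivity.
  set C₁ := B ^ 3 * (2 * (2 * π * I * C₀)) + 1 with hC₁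
  have hC₁0 : 0 < C₁ := by positivity
  refine ⟨C₁ ^ (1 / 4 : ℝ), by positivity, fun M N hM hMN a ha c ξ₀ f hf => ?_⟩
  have hN0 : 0 < N := by linarith
  have hr0 : 0 < M / N := div_pos (by linarith) hN0
  have hS := measurableSet_slab a c ξ₀ M N
  have hint := integrable_fourierRT hS (freqMeasure_slab_lt_top a c ξ₀ M N) hf
  refine ⟨hint, ?_⟩
  set D := N * (M / N) ^ (4 * δ) with hD
  have hD0 : 0 < D := by positivity
  have hmain := lintegral_cutoff_mul_le (φ := φ) hφ.nonneg φ.continuous.measurable φ.integrable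
    (fun τ hτ => hφ.fourierR_eq_zero hτ) hS (measurable_fourierRT f) hint.integrableOn
    (fun k T => hcount M N hM hMN a ha c ξ₀ k T)
  have hpow : ∀ x : ℝ, 0 ≤ x → (x ^ (1 / 4 : ℝ)) ^ 4 = x := fun x hx => by
    rw [← Real.rpow_mul_natCast hx]; norm_num
  have hX : (C₁ ^ (1 / 4 : ℝ) * (M / N) ^ δ * N ^ (1 / 4 : ℝ) * ‖f‖) ^ 4 = C₁ * D * ‖f‖ ^ 4 := by
    have : ((M / N) ^ δ) ^ 4 = (M / N) ^ (4 * δ) := by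
      rw [← Real.rpow_mul_natCast hr0.le, mul_comm]; norm_num
    rw [mul_pow, mul_pow, mul_pow, hpow _ hC₁0.le, hpow _ hN0.le, this, hD]
    ring
  -- Compare fourth powers: the count `N (M/N)^{4δ}` is the fourth power of `N^{1/4} (M/N)^δ`.
  rw [← ENNReal.pow_le_pow_left_iff four_ne_zero, ← ENNReal.ofReal_pow (by positivity), hX]
  have hL := eLpNorm_nnreal_pow_eq_lintegral
    (f := fun p : ℝ × ℝ => (φ p.1 : ℂ) * evolution f p.1 p.2) (μ := volume) (p := 4) four_ne_zero
  have hL' : eLpNorm (fun p : ℝ × ℝ => (φ p.1 : ℂ) * evolution f p.1 p.2) 4 volume ^ 4 =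
      ∫⁻ p : ℝ × ℝ, ‖(φ p.1 : ℂ) * evolution f p.1 p.2‖ₑ ^ 4 := by
    have e : ((4 : NNReal) : ℝ) = ((4 : ℕ) : ℝ) := by norm_num
    simp only [e, ENNReal.rpow_natCast] at hL
    exact hL
  rw [hL']
  calc ∫⁻ p : ℝ × ℝ, ‖(φ p.1 : ℂ) * evolution f p.1 p.2‖ₑ ^ 4
      ≤ ∫⁻ p : ℝ × ℝ, ENNReal.ofReal (B ^ 3) * (ENNReal.ofReal (φ p.1) *
          ‖∫ ξ in slab a c ξ₀ M N, planeWave p ξ * fourierRT f ξ ∂freqMeasure‖ₑ ^ 4) := by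
        refine lintegral_mono fun p => ?_
        rw [evolution_eq_setIntegral hf, enorm_mul, mul_pow, ← mul_assoc,
          ← ENNReal.ofReal_mul (by positivity)]
        gcongr
        rw [← ofReal_norm, Complex.norm_real, Real.norm_of_nonneg (hφ.nonneg _),
          ← ENNReal.ofReal_pow (hφ.nonneg _)]
        apply ENNReal.ofReal_le_ofReal
        rw [pow_succ]
        exact mul_le_mul_of_nonneg_right (pow_le_pow_left₀ (hφ.nonneg _) (hφB _) 3) (hφ.nonneg _)
    _ ≤ ENNReal.ofReal (B ^ 3) *
          (2 * (ENNReal.ofReal (2 * π) * ENNReal.ofReal I * ENNReal.ofReal (C₀ * D)) *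
            (‖f‖ₑ ^ 2) ^ 2) := by
        rw [lintegral_const_mul' _ _ ENNReal.ofReal_ne_top]
        refine mul_le_mul_right (hmain.trans (mul_le_mul_right (pow_le_pow_left' ?_ 2) _)) _
        exact (setLIntegral_le_lintegral _ _).trans (lintegral_enorm_sq_fourierRT_le f)
    _ = ENNReal.ofReal (B ^ 3 * (2 * (2 * π * I * (C₀ * D)) * (‖f‖ ^ 2) ^ 2)) := by
        rw [← ofReal_norm]
        have hf0 := norm_nonneg f
        generalize ‖f‖ = F at hf0
        rw [show (2 : ℝ≥0∞) = ENNReal.ofReal 2 by simp,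
          ← ENNReal.ofReal_pow (by positivity), ← ENNReal.ofReal_pow (by positivity),
          ← ENNReal.ofReal_mul (by positivity), ← ENNReal.ofReal_mul (by positivity),
          ← ENNReal.ofReal_mul (by positivity), ← ENNReal.ofReal_mul (by positivity),
          ← ENNReal.ofReal_mul (by positivity)]
    _ ≤ ENNReal.ofReal (C₁ * D * ‖f‖ ^ 4) := by
        apply ENNReal.ofReal_le_ofReal
        have : 0 ≤ D * ‖f‖ ^ 4 := by positivity
        rw [hC₁]
        linarith
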